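/- **Conventions.** A metric space $X$ is *geodesic* if any two points $x,y$ are joined by an isometrically embedded copy of $[0,d(x,y)]$. A *geodesic surface* is a topological $2$-manifold, possibly with boundary, equipped with a geodesic metric. The length of a loop $\gamma$ is denoted $|\gamma|$, and loops are identified with their images when we speak of equality, intersection and neighbourhoods. A *geodesic circle* in $X$ is an isometrically embedded circle of positive circumference with its geodesic metric. For a subset $A\subset X$ and $r>0$, $N(A,r)$ is the open $r$-neighbourhood of $A$, and $\operatorname{Rips}(A,r)$ is the simplicial complex of nonempty finite subsets of $A$ of diameter less than $r$. For an abelian group $G$, $g\in G$ and a loop $\gamma$, $g[\gamma]\in H_1(X;G)$ is the class of the singular cycle $g\cdot\gamma$. A *deformation contraction* of a metric space $Y$ onto $A\subset Y$, written $Y\xrightarrow{DC}A$, is a continuous map $F\colon Y\times[0,1]\to Y$ with $F(y,0)=y$, $F(y,1)\in A$, $F(a,t)=a$ for all $y\in Y$, $a\in A$, $t\in[0,1]$, and $d(F(x,t'),F(y,t'))\le d(F(x,t),F(y,t))$ for all $x,y\in Y$ and $t<t'$. It is *strict* if the last inequality is strict whenever $x\notin A$ and $y\ne x$. Let $0<D_1\le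 D_2$. A loop $\alpha$ in $X$ is *$DC(D_1,D_2)$-isolated* by closed neighbourhoods $N_1\subset N_2$ of $\alpha$ if: 1. $N_1$ and $N_2$ are homeomorphic to $S^1\times[0,1]$; 2. $N(N_1,D_2)\subset N_2$; 3. the two boundary circles $\alpha_1,\alpha_2$ of the annulus $N_1$ are at distance at least $D_1$ from each other; 4. $\operatorname{Rips}(\alpha_i,r)$ is homotopy equivalent to $S^1$ for $i=1,2$ and all $0<r<D_1$; 5. $N_2\setminus\operatorname{Int}N_1\xrightarrow{DC}\partial N_1$ and $N_1\xrightarrow{DC}\alpha$, where $\partial N_1=\alpha_1\cup\alpha_2$ and $\operatorname{Int}N_1=N_1\setminus\partial N_1$. It is *$SDC(D_1,D_2)$-isolated* by $N_1\subset N_2$ if moreover both deformation contractions in 5 can be taken strict. **Proposition.** Let $X$ be a geodesic surface and let $\alpha$ be a simple loop in $X$ that is $DC(D_1,D_2)$-isolated by $N_1\subset N_2$, where $0<D_1\le D_2$ and $D_2\ge|\alpha|/2$. Let $G$ be an abelian group, $g\in G$ (for example $g=1$ when $G$ is a ring), and suppose that in $H_1(X;G)$ $$g[\alpha]=\sum_{i=1}^k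 c_i[\beta_i]$$ with $c_i\in G$ and loops $\beta_i$ of length at most $|\alpha|$, none of which is equal to $\alpha$. (a) If $X$ is compact, then there are finitely many geodesic circles $\gamma_1,\dots,\gamma_m$ of length at most $|\alpha|$, none of which is equal to $\alpha$, and $b_j\in G$ with $g[\alpha]=\sum_{j=1}^m b_j[\gamma_j]$. If moreover all $\beta_i$ are shorter than $\alpha$, or $\alpha$ is $SDC(D_1,D_2)$-isolated by $N_1\subset N_2$, then the $\gamma_j$ can in addition be chosen so that none of them intersects $N_1$. (b) If all $\beta_i$ are shorter than $\alpha$, or $\alpha$ is $SDC(D_1,D_2)$-isolated by $N_1\subset N_2$ ($X$ not necessarily compact), then every $\beta_i$ that intersects $N_1$ is superfluous: $a[\beta_i]=0$ in $H_1(X;G)$ for all $a\in G$. So after omitting these loops none of the $\beta_i$ intersects $N_1$. -/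

import Mathlib

open Set Topology

universe u

namespace GeodesicSurface

/-! ### Geodesic surfaces -/

/-- Any two points `x, y` are joined by an isometrically embedded copy of `[0, d(x, y)]`. -/
def IsGeodesicSpace (X : Type*) [MetricSpace X] : Prop :=
  ∀ x y : X, ∃ g : ℝ → X, g 0 = x ∧ g (dist x y) = y ∧
    ∀ s ∈ Icc 0 (dist x y), ∀ t ∈ Icc 0 (dist x y), dist (g s) (g t) = |s - t|

/-- A topological surface, possibly with boundary: every point has an open neighbourhood
homeomorphic to an open subset of the closed half-plane.  (Points without boundary are included:
an open disc is homeomorphic to an open disc inside the half-plane.) -/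
def IsSurface (X : Type*) [TopologicalSpace X] : Prop :=
  ∀ x : X, ∃ e : OpenPartialHomeomorph X (EuclideanHalfSpace 2), x ∈ e.source

/-- A surface equipped with a geodesic metric. -/
structure IsGeodesicSurface (X : Type*) [MetricSpace X] : Prop where
  geodesic : IsGeodesicSpace X
  surface : IsSurface X

/-! ### Loops -/

/-- A loop in `X`, parametrized by the circle `ℝ / ℤ`. -/
abbrev Loop (X : Type*) [TopologicalSpace X] : Type _ := C(UnitAddCircle, X)

/-- The length of a loop (possibly infinite): the supremum of the lengths of the inscribed
polygons. -/
noncomputable def Loop.length {X : Type*} [MetricSpace X] (γ : Loop X) : ENNReal :=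
  eVariationOn (fun t : ℝ => γ (t : UnitAddCircle)) (Icc 0 1)

/-- The loop `γ` is the proportional parametrization of an isometrically embedded geodesic circle
of some circumference `L > 0`; here `AddCircle L = ℝ / Lℤ` carries its quotient metric, which is
the geodesic metric of the circle of circumference `L`. -/
def IsGeodesicCircle {X : Type*} [MetricSpace X] (γ : Loop X) : Prop :=
  ∃ L : ℝ, 0 < L ∧ ∃ φ : AddCircle L → X, Isometry φ ∧
    ∀ t : ℝ, γ (t : UnitAddCircle) = φ ((L * t : ℝ) : AddCircle L)

/-! ### The first singular homology class of a loop -/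

section Homology

open CategoryTheory AlgebraicTopology Simplicial

variable {X : Type u} [TopologicalSpace X]

/-- The loop as a path `[0, 1] → X` going once around. -/
noncomputable def Loop.path (γ : Loop X) : TopCat.I.{u} ⟶ TopCat.of X :=
  TopCat.ofHom (γ.comp ((⟨fun t : unitInterval => ((t : ℝ) : UnitAddCircle), by fun_prop⟩ :
    C(unitInterval, UnitAddCircle)).comp (TopCat.I.homeomorph.{u} : C(TopCat.I.{u}, unitInterval))))

/-- The singular `1`-simplex obtained by going once around the loop. -/
noncomputable def Loop.simplex (γ : Loop X) : (TopCat.toSSet.obj (TopCat.of X)) _⦋1⦌ :=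
  TopCat.toSSetObj₁Equiv.symm γ.path

/-- The singular homology group `H₁(X; G)`. -/
noncomputable abbrev H₁ (X : Type u) [TopologicalSpace X] (G : Type u) [AddCommGroup G] :
    AddCommGrpCat.{u} :=
  ((singularHomologyFunctor AddCommGrpCat.{u} 1).obj (AddCommGrpCat.of G)).obj (TopCat.of X)

theorem Loop.simplex_isCycle (γ : Loop X) (G : Type u) [AddCommGroup G] :
    (TopCat.toSSet.obj (TopCat.of X)).ιChainComplex (R := AddCommGrpCat.of G) γ.simplex ≫
      ((TopCat.toSSet.obj (TopCat.of X)).chainComplex (AddCommGrpCat.of G)).d 1 0 = 0 := by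
  rw [SSet.ιChainComplex_d, Fin.sum_univ_two]
  have h : (TopCat.toSSet.obj (TopCat.of X)).δ 0 γ.simplex =
      (TopCat.toSSet.obj (TopCat.of X)).δ 1 γ.simplex := by
    refine (TopCat.δ_zero_toSSetObj₁Equiv.symm γ.path).trans
      (Eq.trans ?_ (TopCat.δ_one_toSSetObj₁Equiv.symm γ.path).symm)
    congr 1
    change γ (((1 : unitInterval) : ℝ) : UnitAddCircle) =
      γ (((0 : unitInterval) : ℝ) : UnitAddCircle)
    rw [show ((1 : unitInterval) : ℝ) = 1 from rfl, show ((0 : unitInterval) : ℝ) = 0 from rfl,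
      AddCircle.coe_period, AddCircle.coe_zero]
  rw [h]
  simp

/-- The homomorphism `G → H₁(X; G)` sending `g` to the homology class of the singular cycle
`g · γ`. -/
noncomputable def Loop.homologyClass (γ : Loop X) (G : Type u) [AddCommGroup G] :
    G →+ H₁ X G :=
  (((TopCat.toSSet.obj (TopCat.of X)).chainComplex (AddCommGrpCat.of G)).liftCycles'
      ((TopCat.toSSet.obj (TopCat.of X)).ιChainComplex γ.simplex) 0 (by simp)
      (γ.simplex_isCycle G) ≫
    ((TopCat.toSSet.obj (TopCat.of X)).chainComplex (AddCommGrpCat.of G)).homologyπ 1).hom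

end Homology

/-! ### Deformation contractions -/

/-- `F` is a deformation contraction of the metric space `Y` onto `A`. -/
structure IsDeformationContraction {Y : Type*} [MetricSpace Y] (A : Set Y)
    (F : C(Y × unitInterval, Y)) : Prop where
  map_zero : ∀ x, F (x, 0) = x
  map_one_mem : ∀ x, F (x, 1) ∈ A
  map_of_mem : ∀ a ∈ A, ∀ t, F (a, t) = a
  dist_le : ∀ x y, ∀ t t' : unitInterval, t < t' →
    dist (F (x, t')) (F (y, t')) ≤ dist (F (x, t)) (F (y, t))

/-- `F` is a strict deformation contraction of the metric space `Y` onto `A`. -/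
structure IsStrictDeformationContraction {Y : Type*} [MetricSpace Y] (A : Set Y)
    (F : C(Y × unitInterval, Y)) : Prop extends IsDeformationContraction A F where
  dist_lt : ∀ x y, x ∉ A → x ≠ y → ∀ t t' : unitInterval, t < t' →
    dist (F (x, t')) (F (y, t')) < dist (F (x, t)) (F (y, t))

/-- The subspace `S` of `X` admits a deformation contraction onto `A`. -/
def ContractsTo {X : Type*} [MetricSpace X] (S A : Set X) : Prop :=
  ∃ F : C(S × unitInterval, S), IsDeformationContraction ((↑) ⁻¹' A) F

/-- The subspace `S` of `X` admits a strict deformation contraction onto `A`. -/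
def StrictlyContractsTo {X : Type*} [MetricSpace X] (S A : Set X) : Prop :=
  ∃ F : C(S × unitInterval, S), IsStrictDeformationContraction ((↑) ⁻¹' A) F

/-! ### Rips complexes and their geometric realizations -/

/-- The open Vietoris-Rips complex: nonempty finite sets of diameter less than `r`. -/
def rips (Y : Type*) [MetricSpace Y] (r : ℝ) : PreAbstractSimplicialComplex Y where
  faces := {σ | σ.Nonempty ∧ Metric.diam (σ : Set Y) < r}
  isRelLowerSet_faces := by
    rintro σ ⟨hσ, hd⟩
    exact ⟨hσ, fun τ hτ hn => ⟨hn, (Metric.diam_mono (by exact_mod_cast hτ)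
      σ.finite_toSet.isBounded).trans_lt hd⟩⟩

/-- The underlying set of the geometric realization of a simplicial complex, in barycentric
coordinates. -/
def Realization {V : Type*} (K : PreAbstractSimplicialComplex V) : Type _ :=
  {w : V →₀ ℝ // (∀ v, 0 ≤ w v) ∧ w.support ∈ K.faces ∧ w.sum (fun _ a => a) = 1}

/-- The closed simplex of the geometric realization spanned by a finite set of vertices. -/
def Realization.Simplex {V : Type*} (K : PreAbstractSimplicialComplex V) (s : Finset V) :
    Type _ :=
  {p : Realization K // p.1.support ⊆ s}

/-- Each closed simplex carries the Euclidean topology of its barycentric coordinates. -/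
instance {V : Type*} (K : PreAbstractSimplicialComplex V) (s : Finset V) :
    TopologicalSpace (Realization.Simplex K s) :=
  TopologicalSpace.induced (fun p (v : s) => p.1.1 v) inferInstance

/-- The weak topology: a set is open if and only if its trace on each closed simplex is open. -/
instance {V : Type*} (K : PreAbstractSimplicialComplex V) : TopologicalSpace (Realization K) :=
  ⨆ s : K.faces, TopologicalSpace.coinduced
    (fun p : Realization.Simplex K s.1 => p.1) inferInstance

/-- `|Rips(A, r)|` is homotopy equivalent to the circle, where `A` carries the subspace metric. -/
def RipsIsCircle {X : Type*} [MetricSpace X] (A : Set X) (r : ℝ) : Prop :=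
  Nonempty (ContinuousMap.HomotopyEquiv (Realization (rips A r)) Circle)

/-! ### Isolated loops -/

section Annulus

variable {X : Type*} [MetricSpace X] {N : Set X} (h : UnitAddCircle × unitInterval ≃ₜ N)

/-- The boundary circle of the annulus `N` at height `i` (used for `i = 0` and `i = 1`). -/
def annulusCircle (i : unitInterval) : Set X := range fun s => (h (s, i) : X)

/-- The boundary `∂N` of the annulus `N` as a surface.  If the ambient surface has no boundary,
it is the topological frontier of `N`. -/
def annulusBoundary : Set X := annulusCircle h 0 ∪ annulusCircle h 1

/-- The interior of the annulus `N` as a surface.  If the ambient surface has no boundary, it is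
the topological interior of `N`. -/
def annulusInterior : Set X := N \ annulusBoundary h

end Annulus

/-- A pair `N₁ ⊆ N₂` of closed neighbourhoods of the loop `α` which exhibits `α` as
`DC(D₁, D₂)` isolated.  The homeomorphism `chart₁` serves to speak about the boundary and the
interior of the annulus `N₁`, which by invariance of domain do not depend on it. -/
structure IsolatingPair {X : Type*} [MetricSpace X] (α : Loop X) (D₁ D₂ : ℝ) where
  N₁ : Set X
  N₂ : Set X
  isClosed₁ : IsClosed N₁
  isClosed₂ : IsClosed N₂
  mem_nhds : N₁ ∈ 𝓝ˢ (range α)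
  subset : N₁ ⊆ N₂
  chart₁ : UnitAddCircle × unitInterval ≃ₜ N₁
  chart₂ : Nonempty (UnitAddCircle × unitInterval ≃ₜ N₂)
  thickening_subset : Metric.thickening D₂ N₁ ⊆ N₂
  apart : ∀ x ∈ annulusCircle chart₁ 0, ∀ y ∈ annulusCircle chart₁ 1, D₁ ≤ dist x y
  rips₀ : ∀ r, 0 < r → r < D₁ → RipsIsCircle (annulusCircle chart₁ 0) r
  rips₁ : ∀ r, 0 < r → r < D₁ → RipsIsCircle (annulusCircle chart₁ 1) r
  outer : ContractsTo (N₂ \ annulusInterior chart₁) (annulusBoundary chart₁)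
  inner : ContractsTo N₁ (range α)

/-- The pair exhibits `α` as `SDC(D₁, D₂)` isolated: the deformation contractions can be taken
strict. -/
structure IsolatingPair.IsStrict {X : Type*} [MetricSpace X] {α : Loop X} {D₁ D₂ : ℝ}
    (P : IsolatingPair α D₁ D₂) : Prop where
  outer : StrictlyContractsTo (P.N₂ \ annulusInterior P.chart₁) (annulusBoundary P.chart₁)
  inner : StrictlyContractsTo P.N₁ (range α)

end GeodesicSurface

open GeodesicSurface

/-! The engine is a retraction `r` of `N₂` onto `α`: collapse the collar `N₂ \ Int N₁` onto `∂N₁`,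
then `N₁` onto `α`. It is homotopic to the identity in `N₂` and does not lengthen curves. The two
collapses glue to a continuous map because both parts of `N₂` are closed; for the collar this is
invariance of domain, proved here in the plane with winding numbers.

Let `β` be a loop with `|β| ≤ |α| ≤ 2 D₂` that meets `N₁`. Each of its points is within `|β| / 2 ≤
D₂` of `N₁`, so `β` lies in `N₂`, and `r ∘ β` is a loop in the circle `α` of some degree `n`. If `n
= 0`, then `β` is null-homologous. If `n ≠ 0`, a lift of `r ∘ β` to the line travels at least `|α|`
per period, so `|α| ≤ |β|`; this settles shorter loops (`homologyClass_eq_zero_of_length_lt`). For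
equal length and strict contractions, a `β` contained in `α` would cover `α` and be equal to it.
Otherwise `r` strictly shortens `β` near a point off `α`, which again contradicts `|α| ≤ |β|`
(`IsStrict.homologyClass_eq_zero`). Here strict decrease of distances becomes strict decrease of arc
length because short arcs of `α` are geodesics (`arcLength_le_dist`).

Geodesic circles come from cutting: a loop parametrized proportionally to arc length is
null-homologous, a geodesic circle, or, cut along a chord shorter than both arcs, homologous to a
sum of two shorter loops (`exists_shortcut`). In a compact surface a bad loop of least Lipschitz
constant exists by Tychonoff and the triviality of small loops, so the cutting yields a
contradiction (`homologyClass_mem_of_length_lt`). Loops of length exactly `|α|` are cut once by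
hand, since there the condition of being different from `α` has to be carried along. -/

namespace GeodesicSurface
/-! ### Chains modulo boundaries -/

section Homology

open CategoryTheory AlgebraicTopology Simplicial

variable {X : Type u} [TopologicalSpace X] (G : Type u) [AddCommGroup G]

/-- The singular `1`-simplex given by a map of the unit interval. -/
noncomputable def pathSimplex (p : C(unitInterval, X)) :
    (TopCat.toSSet.obj (TopCat.of X)) _⦋1⦌ :=
  TopCat.toSSetObj₁Equiv.symm
    (TopCat.ofHom (p.comp (TopCat.I.homeomorph.{u} : C(TopCat.I.{u}, unitInterval))))

/-- The class of the `1`-chain `a · p` modulo boundaries. -/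
noncomputable def pathClass (p : C(unitInterval, X)) :
    G →+ ((TopCat.toSSet.obj (TopCat.of X)).chainComplex (AddCommGrpCat.of G)).opcycles 1 :=
  ((TopCat.toSSet.obj (TopCat.of X)).ιChainComplex (R := AddCommGrpCat.of G) (pathSimplex p) ≫
    ((TopCat.toSSet.obj (TopCat.of X)).chainComplex (AddCommGrpCat.of G)).pOpcycles 1).hom

variable {G}

/-- The path going once around a loop. -/
def Loop.toPath (γ : Loop X) : C(unitInterval, X) :=
  γ.comp ⟨fun t : unitInterval => ((t : ℝ) : UnitAddCircle), by fun_prop⟩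

variable (X G) in
/-- The inclusion of `H₁` into the group of `1`-chains modulo boundaries. -/
noncomputable def H₁.toOpcycles : H₁ X G →+
    ((TopCat.toSSet.obj (TopCat.of X)).chainComplex (AddCommGrpCat.of G)).opcycles 1 :=
  (((TopCat.toSSet.obj (TopCat.of X)).chainComplex (AddCommGrpCat.of G)).homologyι 1).hom

/-- Since `H₁` injects into chains modulo boundaries, all identities between classes of loops can be
checked there, where arcs that are not closed also have classes. -/
theorem Loop.toOpcycles_homologyClass (γ : Loop X) (a : G) :
    H₁.toOpcycles X G (γ.homologyClass G a) = pathClass G γ.toPath a := by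
  set K := (TopCat.toSSet.obj (TopCat.of X)).chainComplex (AddCommGrpCat.of G)
  set f : AddCommGrpCat.of G ⟶ K.cycles 1 :=
    K.liftCycles' ((TopCat.toSSet.obj (TopCat.of X)).ιChainComplex γ.simplex) 0 (by simp)
      (γ.simplex_isCycle G) with hf
  have h : (f ≫ K.homologyπ 1) ≫ K.homologyι 1 =
      (TopCat.toSSet.obj (TopCat.of X)).ιChainComplex (R := AddCommGrpCat.of G)
        (pathSimplex γ.toPath) ≫ K.pOpcycles 1 := by
    rw [Category.assoc, HomologicalComplex.homology_π_ι, hf, HomologicalComplex.liftCycles',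
      HomologicalComplex.liftCycles_i_assoc]
    rfl
  exact congrArg (fun g => g.hom a) h

theorem homologyι_injective (K : ChainComplex AddCommGrpCat.{u} ℕ) (i : ℕ) :
    Function.Injective (K.homologyι i).hom :=
  (AddCommGrpCat.mono_iff_injective _).1 inferInstance

theorem H₁.toOpcycles_injective : Function.Injective (H₁.toOpcycles X G) :=
  homologyι_injective _ 1

/-- The boundary of the singular triangle `s` is `q - r + p`, and it vanishes modulo boundaries. -/
theorem pathClass_triangle (s : C(stdSimplex ℝ (Fin 3), X)) (p q r : C(unitInterval, X))
    (hp : ∀ z : stdSimplex ℝ (Fin 2), p ⟨z 1, z.2.1 1, stdSimplex.le_one z 1⟩ = s (stdSimplex.map (Fin.succAbove 2) z))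
    (hq : ∀ z : stdSimplex ℝ (Fin 2), q ⟨z 1, z.2.1 1, stdSimplex.le_one z 1⟩ = s (stdSimplex.map (Fin.succAbove 0) z))
    (hr : ∀ z : stdSimplex ℝ (Fin 2), r ⟨z 1, z.2.1 1, stdSimplex.le_one z 1⟩ = s (stdSimplex.map (Fin.succAbove 1) z))
    (a : G) :
    pathClass G p a + pathClass G q a = pathClass G r a := by
  set K := (TopCat.toSSet.obj (TopCat.of X)).chainComplex (AddCommGrpCat.of G)
  let S : (TopCat.toSSet.obj (TopCat.of X)) _⦋2⦌ := ((TopCat.of X).toSSetObjEquiv _).symm s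
  have key : ∀ (i : Fin 3) (p : C(unitInterval, X)), (∀ z : stdSimplex ℝ (Fin 2),
      p ⟨z 1, z.2.1 1, stdSimplex.le_one z 1⟩ = s (stdSimplex.map (Fin.succAbove i) z)) →
      (TopCat.toSSet.obj (TopCat.of X)).δ i S = pathSimplex p := by
    intro i p h
    apply ((TopCat.of X).toSSetObjEquiv _).injective
    ext z
    exact (h z).symm
  have h := (TopCat.toSSet.obj (TopCat.of X)).ιChainComplex_d (R := AddCommGrpCat.of G) S
  replace h := h.trans (Fin.sum_univ_three _)
  have h2 := congrArg (fun f => (f ≫ K.pOpcycles 1).hom a) h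
  simp only [Category.assoc] at h2
  rw [HomologicalComplex.d_pOpcycles, key 0 q hq, key 1 r hr, key 2 p hp] at h2
  simp [Preadditive.add_comp] at h2
  change (0 : K.opcycles 1) = pathClass G q a + - pathClass G r a + pathClass G p a at h2
  rw [← sub_eq_zero, h2]
  abel

theorem pathClass_congr {p q : C(unitInterval, X)} (h : ∀ t, p t = q t) :
    pathClass G p = pathClass G q := by
  rw [ContinuousMap.ext h]

/-! ### Images of straight segments and their classes -/

section Segment

variable {E : Type*} [AddCommGroup E] [Module ℝ E] [TopologicalSpace E] [ContinuousAdd E]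
  [ContinuousSMul ℝ E]

/-- The image under `H` of the straight segment from `P` to `Q`. -/
def segPath (H : C(E, X)) (P Q : E) : C(unitInterval, X) :=
  H.comp ⟨fun t => (1 - (t : ℝ)) • P + (t : ℝ) • Q, by fun_prop⟩

theorem segPath_apply (H : C(E, X)) (P Q : E) (t : unitInterval) :
    segPath H P Q t = H ((1 - (t : ℝ)) • P + (t : ℝ) • Q) := rfl

variable (G) in
/-- The class modulo boundaries of the image of a straight segment. -/
noncomputable def segClass (H : C(E, X)) (P Q : E) :
    G →+ ((TopCat.toSSet.obj (TopCat.of X)).chainComplex (AddCommGrpCat.of G)).opcycles 1 :=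
  pathClass G (segPath H P Q)

theorem stdSimplex_map_apply {n : ℕ} (f : Fin 2 → Fin n) (z : stdSimplex ℝ (Fin 2)) (j : Fin n) :
    (stdSimplex.map f z).1 j = (if f 0 = j then z 0 else 0) + (if f 1 = j then z 1 else 0) := by
  change FunOnFinite.linearMap ℝ ℝ _ _ _ = _
  rw [FunOnFinite.linearMap_apply_apply]
  change ∑ i with f i = j, z i = _
  rw [Finset.sum_filter, Fin.sum_univ_two]

theorem segClass_add (H : C(E, X)) (P Q R : E) :
    segClass G H P Q + segClass G H Q R = segClass G H P R := by
  ext a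
  have hz : ∀ z : stdSimplex ℝ (Fin 2), 1 - z 1 = z 0 := fun z => by
    have := stdSimplex.add_eq_one z
    linarith
  refine pathClass_triangle (H.comp ⟨fun z : stdSimplex ℝ (Fin 3) =>
    z.1 0 • P + z.1 1 • Q + z.1 2 • R, by
      have h (i : Fin 3) : Continuous fun z : stdSimplex ℝ (Fin 3) => z.1 i :=
        (continuous_apply i).comp continuous_subtype_val
      exact (((h 0).smul continuous_const).add ((h 1).smul continuous_const)).add
        ((h 2).smul continuous_const)⟩) _ _ _ ?_ ?_ ?_ a <;> intro z
  all_goals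
    simp only [segPath_apply, ContinuousMap.comp_apply, ContinuousMap.coe_mk, hz]
    congr 1
  all_goals
    rw [stdSimplex_map_apply, stdSimplex_map_apply, stdSimplex_map_apply]
  · rw [if_pos (by decide), if_neg (by decide), if_neg (by decide), if_pos (by decide),
      if_neg (by decide), if_neg (by decide)]
    simp
  · rw [if_neg (by decide), if_neg (by decide), if_pos (by decide), if_neg (by decide),
      if_neg (by decide), if_pos (by decide)]
    simp
  · rw [if_pos (by decide), if_neg (by decide), if_neg (by decide), if_neg (by decide),
      if_neg (by decide), if_pos (by decide)]
    simp

@[simp]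
theorem segClass_self (H : C(E, X)) (P : E) : segClass G H P P = 0 := by
  simpa using segClass_add (G := G) H P P P

theorem segClass_symm (H : C(E, X)) (P Q : E) : segClass G H Q P = -segClass G H P Q := by
  rw [eq_neg_iff_add_eq_zero, segClass_add, segClass_self]

/-- Both ways around the quadrilateral agree with the diagonal from `P` to `Q'`; the equal sides
`PP'` and `QQ'` then cancel. This is the form in which homotopies enter. -/
theorem segClass_quad (H : C(E, X)) (P Q P' Q' : E) (h : segClass G H P P' = segClass G H Q Q') :
    segClass G H P Q = segClass G H P' Q' := by
  have h1 := segClass_add (G := G) H P Q Q'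
  have h2 := segClass_add (G := G) H P P' Q'
  rw [← h2, h, add_comm] at h1
  exact add_left_cancel h1

theorem segClass_const (x : X) (P Q : E) : segClass G (ContinuousMap.const E x) P Q = 0 := by
  rw [← segClass_self (G := G) (ContinuousMap.const E x) P]
  rfl

/-- A curve in a vector space may be straightened without changing its class. -/
theorem segClass_comp (H : C(E, X)) (f : C(ℝ, E)) :
    segClass G (H.comp f) 0 1 = segClass G H (f 0) (f 1) := by
  let K : C(ℝ × ℝ, X) := H.comp
    ⟨fun z => (1 - z.2) • f z.1 + z.2 • ((1 - z.1) • f 0 + z.1 • f 1), by fun_prop⟩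
  have h := segClass_quad (G := G) K (0, 0) (1, 0) (0, 1) (1, 1) ?_
  · refine Eq.trans (pathClass_congr fun t => ?_) (h.trans (pathClass_congr fun t => ?_)) <;>
    simp [segPath_apply, K]
  · have h0 : segClass G K (0, 0) (0, 1) = segClass G (ContinuousMap.const E (H (f 0))) 0 0 :=
      pathClass_congr fun t => by simp [segPath_apply, K, ← add_smul]
    have h1 : segClass G K (1, 0) (1, 1) = segClass G (ContinuousMap.const E (H (f 1))) 0 0 :=
      pathClass_congr fun t => by simp [segPath_apply, K, ← add_smul]
    rw [h0, h1, segClass_const, segClass_const]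

end Segment

/-- A loop as a periodic map on the real line. -/
def Loop.line (γ : Loop X) : C(ℝ, X) :=
  γ.comp ⟨fun t : ℝ => (t : UnitAddCircle), by fun_prop⟩

theorem Loop.line_apply (γ : Loop X) (t : ℝ) : γ.line t = γ (t : UnitAddCircle) := rfl

theorem Loop.pathClass_toPath (γ : Loop X) : pathClass G γ.toPath = segClass G γ.line 0 1 :=
  pathClass_congr fun t => by simp [segPath_apply, Loop.line, Loop.toPath]

theorem Loop.toOpcycles_homologyClass' (γ : Loop X) (a : G) :
    H₁.toOpcycles X G (γ.homologyClass G a) = segClass G γ.line 0 1 a := by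
  rw [Loop.toOpcycles_homologyClass, Loop.pathClass_toPath]

theorem Loop.homologyClass_eq_of_segClass_eq {γ γ' : Loop X}
    (h : segClass G γ.line 0 1 = segClass G γ'.line 0 1) :
    γ.homologyClass G = γ'.homologyClass G := by
  ext a
  apply H₁.toOpcycles_injective
  rw [Loop.toOpcycles_homologyClass', Loop.toOpcycles_homologyClass', h]

theorem Loop.homologyClass_eq_zero {γ : Loop X}
    (h : segClass G γ.line 0 1 = 0) : γ.homologyClass G = 0 := by
  ext a
  apply H₁.toOpcycles_injective
  rw [Loop.toOpcycles_homologyClass', h, AddMonoidHom.zero_apply, AddMonoidHom.zero_apply, map_zero]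

theorem Loop.homologyClass_eq_add {γ γ₁ γ₂ : Loop X}
    (h : segClass G γ.line 0 1 = segClass G γ₁.line 0 1 + segClass G γ₂.line 0 1) :
    γ.homologyClass G = γ₁.homologyClass G + γ₂.homologyClass G := by
  ext a
  apply H₁.toOpcycles_injective
  rw [Loop.toOpcycles_homologyClass', h, AddMonoidHom.add_apply, AddMonoidHom.add_apply, map_add,
    Loop.toOpcycles_homologyClass', Loop.toOpcycles_homologyClass']

theorem Loop.segClass_eq_of_homotopic {γ γ' : Loop X} (h : γ.Homotopic γ') :
    segClass G γ.line 0 1 = segClass G γ'.line 0 1 := by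
  obtain ⟨F⟩ := h
  let K : C(ℝ × ℝ, X) := F.toContinuousMap.comp
    ⟨fun z => (projIcc 0 1 zero_le_one z.2, (z.1 : UnitAddCircle)), by fun_prop⟩
  have h := segClass_quad (G := G) K (0, 0) (1, 0) (0, 1) (1, 1) ?_
  · refine Eq.trans (pathClass_congr fun t => ?_) (h.trans (pathClass_congr fun t => ?_))
    · simp [segPath_apply, K, Loop.line]
    · simp [segPath_apply, K, Loop.line]
  · refine pathClass_congr fun t => ?_
    simp [segPath_apply, K, AddCircle.coe_period (1 : ℝ)]

theorem Loop.homologyClass_eq_of_homotopic {γ γ' : Loop X} (h : γ.Homotopic γ') :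
    γ.homologyClass G = γ'.homologyClass G :=
  Loop.homologyClass_eq_of_segClass_eq (Loop.segClass_eq_of_homotopic h)

end Homology

/-! ### Invariance of domain in the plane -/

section Plane

open Complex

theorem exists_continuous_log {A : Type*} [TopologicalSpace A] [SimplyConnectedSpace A]
    [LocallyPathConnectedSpace A] (f : C(A, ℂ)) (hf : ∀ a, f a ≠ 0) :
    ∃ l : C(A, ℂ), ∀ a, exp (l a) = f a := by
  obtain ⟨a₀⟩ : Nonempty A := inferInstance
  obtain ⟨l, ⟨-, hl⟩, -⟩ := isCoveringMapOn_exp.existsUnique_continuousMap_lifts f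
    (a₀ := a₀) (e₀ := log (f a₀)) (exp_log (hf a₀)) (fun a => by simpa using hf a)
  exact ⟨l, fun a => congrFun hl a⟩

theorem eq_of_exp_const {h : ℝ → ℂ} (hh : Continuous h) {w : ℂ} (hw : ∀ t, exp (h t) = w)
    (s t : ℝ) : h s = h t := by
  have := isCoveringMap_exp.eq_of_comp_eq hh (continuous_const (y := h t))
    (by ext x; simp [hw]) t rfl
  exact congrFun this s

/-- The curve has a continuous logarithm on `[0, 1]` with equal values at the endpoints: its
winding number around `0` vanishes. -/
def HasClosedLog (g : ℝ → ℂ) : Prop :=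
  ∃ l : ℝ → ℂ, Continuous l ∧ (∀ t, exp (l t) = g t) ∧ l 1 = l 0

/-- The plane is simply connected, so `G` has a logarithm `L` there. The jump `L (1, x) - L (0, x)`
lies in `2πiℤ` and is continuous in `x`, hence constant, and at `x = 0` it agrees with the jump of
`l`. -/
theorem HasClosedLog.of_homotopy {G : ℝ × ℝ → ℂ} (hG : Continuous G) (h0 : ∀ z, G z ≠ 0)
    (h1 : ∀ x, G (1, x) = G (0, x)) (h : HasClosedLog fun t => G (t, 0)) :
    HasClosedLog fun t => G (t, 1) := by
  obtain ⟨L, hL⟩ := exists_continuous_log ⟨G, hG⟩ h0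
  obtain ⟨l, hl, hle, hl1⟩ := h
  simp only [ContinuousMap.coe_mk] at hL
  refine ⟨fun t => L (t, 1), by fun_prop, fun t => hL _, ?_⟩
  have e1 : L (1, 0) - l 1 = L (0, 0) - l 0 :=
    eq_of_exp_const (h := fun t => L (t, 0) - l t) (by fun_prop) (w := 1)
      (fun t => by rw [exp_sub, hL, hle, div_self (h0 _)]) 1 0
  have e2 : L (1, 1) - L (0, 1) = L (1, 0) - L (0, 0) :=
    eq_of_exp_const (h := fun x => L (1, x) - L (0, x)) (by fun_prop) (w := 1)
      (fun t => by rw [exp_sub, hL, hL, h1, div_self (h0 _)]) 1 0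
  rw [hl1] at e1
  linear_combination e2 + e1

/-- The increment of a logarithm over half a period is a constant with exponential `-1`. Twice this
constant is the total increment, so a closed logarithm would make it `0`. -/
theorem HasClosedLog.not_of_antiperiodic {g : ℝ → ℂ} (hg : ∀ t, g (t + 1 / 2) = -g t) :
    ¬ HasClosedLog g := by
  rintro ⟨l, hl, hle, hl1⟩
  have hw : ∀ t, exp (l (t + 1 / 2) - l t) = -1 := fun t => by
    have : g t ≠ 0 := by rw [← hle]; exact exp_ne_zero _
    rw [exp_sub, hle, hle, hg, neg_div, div_self this]
  have e1 := eq_of_exp_const (h := fun t => l (t + 1 / 2) - l t) (by fun_prop) hw (1 / 2) 0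
  have e2 := hw 0
  norm_num at e1 e2
  have e3 : l (1 / 2) - l 0 = 0 := by
    linear_combination (-1 / 2) * e1 + (1 / 2) * hl1
  rw [e3, exp_zero] at e2
  norm_num at e2

/-- **Invariance of domain** in the plane: the image of a closed disc under an injective
continuous map is a neighbourhood of the image of its centre. -/
theorem image_closedBall_mem_nhds {f : ℂ → ℂ} (hf : ContinuousOn f (Metric.closedBall 0 1))
    (hi : InjOn f (Metric.closedBall 0 1)) : f '' Metric.closedBall 0 1 ∈ 𝓝 (f 0) := by
  let e : ℝ → ℂ := fun t => exp (2 * Real.pi * I * t)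
  have he : Continuous e := by fun_prop
  have hen : ∀ t, ‖e t‖ = 1 := fun t => by
    simp [e, norm_exp]
  have he0 : ∀ t, e t ≠ 0 := fun t => exp_ne_zero _
  have he1 : e 1 = e 0 := by simp [e]
  have heh : ∀ t, e (t + 1 / 2) = - e t := fun t => by
    simp only [e]
    push_cast
    rw [mul_add, exp_add, show 2 * (Real.pi : ℂ) * I * (1 / 2) = Real.pi * I by ring, exp_pi_mul_I]
    ring
  let c : ℝ → ℝ := fun x => projIcc (0 : ℝ) 1 zero_le_one x
  have hc : Continuous c := by fun_prop
  have hc0 : ∀ x, 0 ≤ c x := fun x => (projIcc (0 : ℝ) 1 zero_le_one x).2.1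
  have hc1 : ∀ x, c x ≤ 1 := fun x => (projIcc (0 : ℝ) 1 zero_le_one x).2.2
  have c0 : c 0 = 0 := by simp [c]
  have c1 : c 1 = 1 := by simp [c]
  have hmem : ∀ (t r : ℝ), |r| ≤ 1 → (r : ℂ) * e t ∈ Metric.closedBall (0 : ℂ) 1 := fun t r h => by
    simpa [hen] using h
  have hcomp : ∀ {r : ℝ → ℝ}, Continuous r → (∀ x, |r x| ≤ 1) →
      Continuous fun z : ℝ × ℝ => f ((r z.2 : ℂ) * e z.1) := fun {r} hr h =>
    hf.comp_continuous (by fun_prop) fun z => hmem _ _ (h _)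
  have hone : Continuous fun z : ℝ × ℝ => f (e z.1) := by
    simpa using hcomp (r := fun _ => 1) continuous_const (by simp)
  have hem : ∀ t, e t ∈ Metric.closedBall (0 : ℂ) 1 := fun t => by
    simpa using hmem t 1 (by simp)
  have h0m : (0 : ℂ) ∈ Metric.closedBall (0 : ℂ) 1 := by simp
  -- the distance from `f 0` to the image of the boundary
  obtain ⟨δ, hδ, hδe⟩ : ∃ δ > 0, ∀ t, δ ≤ ‖f (e t) - f 0‖ := by
    obtain ⟨z, hz, hmin⟩ := (isCompact_sphere (0 : ℂ) 1).exists_isMinOn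
      (by simp)
      (f := fun z => ‖f z - f 0‖)
      ((((hf.mono Metric.sphere_subset_closedBall).sub continuousOn_const)).norm)
    refine ⟨‖f z - f 0‖, ?_, fun t => hmin (by simp [hen])⟩
    rw [gt_iff_lt, norm_pos_iff, sub_ne_zero]
    intro h
    have := hi (Metric.sphere_subset_closedBall hz) h0m h
    simp [this] at hz
  refine Filter.mem_of_superset (Metric.ball_mem_nhds _ hδ) fun y hy => ?_
  by_contra hyn
  rw [Metric.mem_ball, dist_eq_norm] at hy
  have hny : ∀ z ∈ Metric.closedBall (0 : ℂ) 1, f z - y ≠ 0 := fun z hz h =>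
    hyn ⟨z, hz, sub_eq_zero.1 h⟩
  -- shrink the boundary circle to the centre
  have p1 : HasClosedLog fun t => f (e t) - y := by
    have := HasClosedLog.of_homotopy (G := fun z => f ((c z.2 : ℂ) * e z.1) - y)
      ((hcomp hc fun x => by rw [abs_of_nonneg (hc0 x)]; exact hc1 x).sub continuous_const)
      (fun z => hny _ (hmem _ _ (by rw [abs_of_nonneg (hc0 _)]; exact hc1 _)))
      (fun x => by simp [he1])
      (by
        simp only [c0, ofReal_zero, zero_mul]
        exact ⟨fun _ => log (f 0 - y), continuous_const, fun t => exp_log (hny _ h0m), rfl⟩)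
    simpa [c1] using this
  -- move `y` to `f 0`
  have p2 : HasClosedLog fun t => f (e t) - f 0 := by
    have := HasClosedLog.of_homotopy
      (G := fun z => f (e z.1) - (y + (c z.2 : ℂ) * (f 0 - y)))
      (hone.sub (by fun_prop))
      -- At a zero, `f (e t) - f 0` would be `1 - c` times `y - f 0`, hence of norm less than `δ`.
      (fun z => by
        intro h
        have h2 : f (e z.1) - f 0 = ((1 - c z.2 : ℝ) : ℂ) * (y - f 0) := by
          push_cast; linear_combination h
        have h3 := hδe z.1
        rw [h2, norm_mul, norm_real, Real.norm_of_nonneg (by linarith [hc1 z.2])] at h3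
        nlinarith [hc0 z.2, norm_nonneg (y - f 0)])
      (fun x => by simp [he1]) (by simpa [c0] using p1)
    simpa [c1] using this
  -- deform to an odd curve
  have p3 := HasClosedLog.of_homotopy
    (G := fun z => f (((1 / (1 + c z.2) : ℝ) : ℂ) * e z.1) -
      f (((-(c z.2 / (1 + c z.2)) : ℝ) : ℂ) * e z.1)) ?_ ?_ (fun x => by simp only [he1]) ?_
  -- At `c = 1` the curve is `f (e t / 2) - f (-e t / 2)`, which changes sign under a half turn. At
  -- `c = 0` it is `f (e t) - f 0`, and by injectivity no zero occurs on the way.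
  · refine HasClosedLog.not_of_antiperiodic (fun t => ?_) p3
    simp only [c1, heh]
    norm_num
  · refine (hcomp (r := fun x => 1 / (1 + c x)) ?_ fun x => ?_).sub
      (hcomp (r := fun x => -(c x / (1 + c x))) ?_ fun x => ?_)
    · exact continuous_const.div (by fun_prop) fun x => by linarith [hc0 x]
    · rw [abs_of_nonneg (by have := hc0 x; positivity), div_le_one (by linarith [hc0 x])]
      linarith [hc0 x]
    · exact (hc.div (by fun_prop) fun x => by linarith [hc0 x]).neg
    · rw [abs_neg, abs_of_nonneg (by have := hc0 x; positivity), div_le_one (by linarith [hc0 x])]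
      linarith [hc0 x]
  · intro z h
    have hp : 0 < 1 + c z.2 := by linarith [hc0 z.2]
    have := hi (hmem _ _ ?_) (hmem _ _ ?_) (sub_eq_zero.1 h)
    · have h2 := mul_right_cancel₀ (he0 _) this
      rw [ofReal_inj, ← neg_div, div_left_inj' hp.ne'] at h2
      linarith [hc0 z.2]
    · rw [abs_of_nonneg (by positivity), div_le_one hp]
      linarith [hc0 z.2]
    · rw [abs_neg, abs_of_nonneg (by have := hc0 z.2; positivity), div_le_one hp]
      linarith [hc0 z.2]
  · simpa [c0] using p2

end Plane

/-- Invariance of domain for surfaces. -/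
theorem IsSurface.image_closedBall_mem_nhds {X : Type*} [TopologicalSpace X] (hX : IsSurface X)
    {k : ℂ → X} (hk : ContinuousOn k (Metric.closedBall 0 1))
    (hi : InjOn k (Metric.closedBall 0 1)) : k '' Metric.closedBall 0 1 ∈ 𝓝 (k 0) := by
  obtain ⟨e, he⟩ := hX (k 0)
  let q : EuclideanHalfSpace 2 → ℂ := fun x => ⟨x.1 0, x.1 1⟩
  have hq : Continuous q := by
    have h : Continuous fun x : EuclideanHalfSpace 2 => ((x.1 0 : ℝ) : ℂ) + (x.1 1 : ℝ) * Complex.I := by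
      have hc (i : Fin 2) : Continuous fun x : EuclideanHalfSpace 2 => x.1 i := by fun_prop
      have h0 := hc 0
      have h1 := hc 1
      fun_prop
    exact h.congr fun x => Complex.mk_eq_add_mul_I _ _ |>.symm
  have hqi : Function.Injective q := fun x y h => by
    apply Subtype.ext
    ext i
    fin_cases i
    · exact congrArg Complex.re h
    · exact congrArg Complex.im h
  have h0 : Metric.closedBall (0 : ℂ) 1 ∈ 𝓝 0 := Metric.closedBall_mem_nhds _ one_pos
  have hpre : k ⁻¹' e.source ∈ 𝓝 (0 : ℂ) :=
    (hk.continuousAt h0).preimage_mem_nhds (e.open_source.mem_nhds he)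
  obtain ⟨ρ, hρ, hρs⟩ := Metric.nhds_basis_closedBall.mem_iff.1 (Filter.inter_mem h0 hpre)
  have hm : ∀ z ∈ Metric.closedBall (0 : ℂ) 1, (ρ : ℂ) * z ∈ Metric.closedBall (0 : ℂ) ρ := by
    intro z hz
    simp only [mem_closedBall_zero_iff, norm_mul, Complex.norm_real, Real.norm_eq_abs,
      abs_of_pos hρ] at hz ⊢
    nlinarith
  have hmap : MapsTo (fun z : ℂ => (ρ : ℂ) * z) (Metric.closedBall 0 1)
    (Metric.closedBall 0 1 ∩ k ⁻¹' e.source) := fun z hz => hρs (hm z hz)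
  -- The disc is shrunk by `ρ` so that its image lies in one chart, and the half-plane is viewed
  -- inside `ℂ` by `q`. The resulting neighbourhood is pulled back along the injective map `q ∘ e`.
  have key := GeodesicSurface.image_closedBall_mem_nhds (f := fun z => q (e (k (ρ * z)))) ?_ ?_
  · have h2 : (fun x => q (e x)) ⁻¹' ((fun z : ℂ => q (e (k (ρ * z)))) '' Metric.closedBall 0 1) ∩
        e.source ∈ 𝓝 (k 0) := by
      refine Filter.inter_mem (ContinuousAt.preimage_mem_nhds ?_ ?_) (e.open_source.mem_nhds he)
      · exact hq.continuousAt.comp (e.continuousAt he)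
      · simpa using key
    refine Filter.mem_of_superset h2 ?_
    rintro x ⟨⟨z, hz, hzx⟩, hx⟩
    exact ⟨ρ * z, (hmap hz).1, e.injOn (hmap hz).2 hx (hqi hzx)⟩
  · refine hq.comp_continuousOn (e.continuousOn.comp (hk.comp (by fun_prop) fun z hz => (hmap hz).1)
      fun z hz => (hmap hz).2)
  · intro z hz w hw h
    have h2 := hi (hmap hz).1 (hmap hw).1 (e.injOn (hmap hz).2 (hmap hw).2 (hqi h))
    exact mul_left_cancel₀ (by exact_mod_cast hρ.ne') h2

/-! ### Interior and boundary of an annulus in a surface -/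

section Annulus

variable {X : Type*} [MetricSpace X] {N : Set X} (h : UnitAddCircle × unitInterval ≃ₜ N)

theorem isCompact_annulusCircle (i : unitInterval) : IsCompact (annulusCircle h i) :=
  isCompact_range (by fun_prop)

theorem isCompact_annulusBoundary : IsCompact (annulusBoundary h) :=
  (isCompact_annulusCircle h 0).union (isCompact_annulusCircle h 1)

theorem annulusBoundary_subset : annulusBoundary h ⊆ N := by
  rintro x (⟨s, rfl⟩ | ⟨s, rfl⟩) <;> exact (h _).2

/-- Interior points of an annulus in a surface are topological interior points. -/
theorem mem_nhds_of_mem_annulusInterior (hX : IsSurface X) {x : X}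
    (hx : x ∈ annulusInterior h) : N ∈ 𝓝 x := by
  obtain ⟨hxN, hxb⟩ := hx
  obtain ⟨⟨s, v⟩, hsv⟩ := h.surjective ⟨x, hxN⟩
  have hx' : x = h (s, v) := by rw [hsv]
  have hv0 : 0 < (v : ℝ) := lt_of_le_of_ne v.2.1 fun hv => hxb <| Or.inl
    ⟨s, by rw [hx', show v = 0 from Subtype.ext hv.symm]⟩
  have hv1 : (v : ℝ) < 1 := lt_of_le_of_ne v.2.2 fun hv => hxb <| Or.inr
    ⟨s, by rw [hx', show v = 1 from Subtype.ext hv]⟩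
  -- With `ρ ≤ v` and `ρ ≤ 1 - v` the disc stays within the heights `[0, 1]`, so that `projIcc` acts
  -- as the identity; with `ρ < 1 / 2` it does not overlap itself around the circle.
  obtain ⟨ρ, hρ, hρ1, hρ2, hρ3⟩ : ∃ ρ : ℝ, 0 < ρ ∧ ρ ≤ v ∧ ρ ≤ 1 - v ∧ ρ < 1 / 2 :=
    ⟨min (min v (1 - v)) (1 / 3), by simp [hv0, hv1], (min_le_left _ _).trans (min_le_left _ _),
      (min_le_left _ _).trans (min_le_right _ _), (min_le_right _ _).trans_lt (by norm_num)⟩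
  let k : ℂ → X := fun z =>
    h (s + ((ρ * z.re : ℝ) : UnitAddCircle), projIcc 0 1 zero_le_one ((v : ℝ) + ρ * z.im))
  have hk0 : k 0 = x := by simp [k, hx']
  have hk : Continuous k := by fun_prop
  have key := hX.image_closedBall_mem_nhds hk.continuousOn (k := k) ?_
  · rw [hk0] at key
    refine Filter.mem_of_superset key ?_
    rintro _ ⟨z, -, rfl⟩
    exact (h _).2
  · intro z hz w hw hzw
    rw [mem_closedBall_zero_iff] at hz hw
    have hzr := (abs_le.1 ((Complex.abs_re_le_norm z).trans hz))
    have hzi := (abs_le.1 ((Complex.abs_im_le_norm z).trans hz))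
    have hwr := (abs_le.1 ((Complex.abs_re_le_norm w).trans hw))
    have hwi := (abs_le.1 ((Complex.abs_im_le_norm w).trans hw))
    have h1 := h.injective (Subtype.ext hzw)
    rw [Prod.mk.injEq, add_right_inj] at h1
    apply Complex.ext
    · have h2 : ((ρ * z.re - ρ * w.re : ℝ) : UnitAddCircle) = 0 := by
        rw [AddCircle.coe_sub, h1.1, sub_self]
      obtain ⟨n, hn⟩ := (AddCircle.coe_eq_zero_iff (1 : ℝ)).1 h2
      have hn2 : (n : ℝ) = ρ * z.re - ρ * w.re := by simpa using hn
      have hn3 : n = 0 := by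
        have a1 : (n : ℝ) < 1 := by rw [hn2]; nlinarith
        have a2 : (-1 : ℝ) < n := by rw [hn2]; nlinarith
        have a1' : n < 1 := by exact_mod_cast a1
        have a2' : -1 < n := by exact_mod_cast a2
        omega
      rw [hn3, Int.cast_zero] at hn2
      exact mul_left_cancel₀ hρ.ne' (by linarith)
    · have h2 := congrArg Subtype.val h1.2
      rw [projIcc_of_mem _ ⟨by nlinarith, by nlinarith⟩,
        projIcc_of_mem _ ⟨by nlinarith, by nlinarith⟩] at h2
      exact mul_left_cancel₀ hρ.ne' (by linarith [show (v : ℝ) + ρ * z.im = v + ρ * w.im from h2])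

theorem isOpen_annulusInterior (hX : IsSurface X) : IsOpen (annulusInterior h) := by
  rw [isOpen_iff_mem_nhds]
  intro x hx
  exact Filter.inter_mem (mem_nhds_of_mem_annulusInterior h hX hx)
    ((isCompact_annulusBoundary h).isClosed.isOpen_compl.mem_nhds hx.2)

end Annulus

/-! ### Lengths of loops -/

section Length

variable {X : Type*} [MetricSpace X]

theorem eVariationOn_comp_affine (f : ℝ → X) {c : ℝ} (hc : 0 ≤ c) (b s t : ℝ) (hst : s ≤ t) :
    eVariationOn (fun x => f (c * x + b)) (Icc s t) = eVariationOn f (Icc (c * s + b) (c * t + b)) := by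
  have := eVariationOn.comp_eq_of_monotoneOn f (t := Icc s t) (fun x => c * x + b)
    (fun x _ y _ h => by simpa using mul_le_mul_of_nonneg_left h hc)
  refine this.trans ?_
  congr 1
  rcases hc.eq_or_lt with rfl | hc
  · simp [(nonempty_Icc.2 hst).image_const]
  · rw [image_affine_Icc' hc]

theorem eVariationOn_Icc_add (f : ℝ → X) {a b c : ℝ} (hab : a ≤ b) (hbc : b ≤ c) :
    eVariationOn f (Icc a b) + eVariationOn f (Icc b c) = eVariationOn f (Icc a c) := by
  simpa using eVariationOn.Icc_add_Icc f (s := univ) hab hbc (mem_univ b)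

/-- The variation of a curve is at least that of the arc which it runs through. -/
theorem eVariationOn_le_comp (f : ℝ → X) {w : ℝ → ℝ} {a b : ℝ} (hw : ContinuousOn w (Icc a b))
    (hab : a ≤ b) :
    eVariationOn f (Icc (w a) (w b)) ≤ eVariationOn (f ∘ w) (Icc a b) := by
  let S : ℝ → Set ℝ := fun u => {x ∈ Icc a b | u ≤ w x}
  have hb : ∀ u ≤ w b, b ∈ S u := fun u hu => ⟨right_mem_Icc.2 hab, hu⟩
  have hbdd : ∀ u, BddBelow (S u) := fun u => ⟨a, fun x hx => hx.1.1⟩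
  have hcl : ∀ u, IsClosed (S u) := fun u => by
    have : S u = Icc a b ∩ w ⁻¹' Ici u := rfl
    rw [this]
    exact hw.preimage_isClosed_of_isClosed isClosed_Icc isClosed_Ici
  -- The first time at which `w` reaches the level `u`: a monotone right inverse of `w`, so that `f
  -- = (f ∘ w) ∘ τ` has no more variation than `f ∘ w`.
  let τ : ℝ → ℝ := fun u => sInf (S u)
  have hτ : ∀ u ≤ w b, τ u ∈ S u := fun u hu => (hcl u).csInf_mem ⟨b, hb u hu⟩ (hbdd u)
  have hmono : MonotoneOn τ (Icc (w a) (w b)) := fun u _ v hv huv =>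
    csInf_le_csInf (hbdd u) ⟨b, hb v hv.2⟩ fun x hx => ⟨hx.1, huv.trans hx.2⟩
  have hwτ : ∀ u ∈ Icc (w a) (w b), w (τ u) = u := by
    intro u hu
    obtain ⟨h1, h2⟩ := hτ u hu.2
    obtain ⟨y, hy, hyu⟩ := intermediate_value_Icc h1.1 (hw.mono (Icc_subset_Icc_right h1.2))
      ⟨hu.1, h2⟩
    have : τ u ≤ y := csInf_le (hbdd u) ⟨⟨hy.1, hy.2.trans h1.2⟩, hyu.ge⟩
    rw [le_antisymm this hy.2, hyu]
  calc eVariationOn f (Icc (w a) (w b)) = eVariationOn ((f ∘ w) ∘ τ) (Icc (w a) (w b)) :=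
        eVariationOn.congr fun u hu => by simp [hwτ u hu]
    _ ≤ _ := eVariationOn.comp_le_of_monotoneOn _ τ hmono fun u hu => (hτ u hu.2).1

theorem eVariationOn_le_comp' (f : ℝ → X) {w : ℝ → ℝ} {a b : ℝ} (hw : ContinuousOn w (Icc a b))
    (hab : a ≤ b) :
    eVariationOn f (uIcc (w a) (w b)) ≤ eVariationOn (f ∘ w) (Icc a b) := by
  rcases le_total (w a) (w b) with h | h
  · rw [uIcc_of_le h]
    exact eVariationOn_le_comp f hw hab
  · rw [uIcc_of_ge h]
    have hm : MapsTo (fun x => a + b - x) (Icc a b) (Icc a b) := fun x hx =>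
      ⟨by linarith [hx.2], by linarith [hx.1]⟩
    have h1 := eVariationOn_le_comp f (w := fun x => w (a + b - x)) (a := a) (b := b)
      (hw.comp (by fun_prop) hm) hab
    simp only [add_sub_cancel_left, add_sub_cancel_right] at h1
    exact h1.trans (eVariationOn.comp_le_of_antitoneOn (f ∘ w) (fun x => a + b - x)
      (fun x _ y _ hxy => by dsimp only; linarith) hm)

namespace Loop

theorem line_add_one (γ : Loop X) (t : ℝ) : γ.line (t + 1) = γ.line t := by
  simp [line_apply]

theorem line_add_int (γ : Loop X) (t : ℝ) (n : ℤ) : γ.line (t + n) = γ.line t := by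
  have : Function.Periodic γ.line 1 := γ.line_add_one
  simpa using this.int_mul n t

theorem range_line (γ : Loop X) : range γ.line = range γ :=
  (QuotientAddGroup.mk_surjective (s := AddSubgroup.zmultiples (1 : ℝ))).range_comp γ

theorem length_eq (γ : Loop X) : γ.length = eVariationOn γ.line (Icc 0 1) := rfl

theorem eVariationOn_int (γ : Loop X) (n : ℤ) :
    eVariationOn γ.line (Icc n (n + 1)) = γ.length := by
  have := eVariationOn_comp_affine γ.line zero_le_one n 0 1 zero_le_one
  simp only [one_mul, line_add_int, zero_add] at this
  rw [length_eq, add_comm, ← this]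

theorem locallyBoundedVariationOn (γ : Loop X) (hγ : γ.length ≠ ⊤) :
    LocallyBoundedVariationOn γ.line univ := by
  intro a b _ _
  rw [univ_inter]
  obtain ⟨m, hm⟩ := exists_int_lt a
  obtain ⟨n, hn⟩ := exists_nat_gt (b - m)
  have h1 := eVariationOn.sum' γ.line (I := fun i : ℕ => (m : ℝ) + i) (n := n)
    (fun i j hij => by simpa using hij)
  have h2 : eVariationOn γ.line (Icc (m : ℝ) (m + n)) ≠ ⊤ := by
    simp only [Nat.cast_zero, add_zero] at h1
    rw [← h1]
    refine ENNReal.sum_ne_top.2 fun i _ => ?_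
    have := γ.eVariationOn_int (m + i)
    push_cast at this ⊢
    rw [← add_assoc, this]
    exact hγ
  exact BoundedVariationOn.mono h2 (Icc_subset_Icc hm.le (by linarith))

/-- The arc length of a loop measured from its base point. -/
noncomputable def arcLength (γ : Loop X) (t : ℝ) : ℝ := variationOnFromTo γ.line univ 0 t

variable {γ : Loop X} (hγ : γ.length ≠ ⊤)

include hγ in
theorem arcLength_sub (s t : ℝ) :
    γ.arcLength t - γ.arcLength s = variationOnFromTo γ.line univ s t :=
  variationOnFromTo.sub_right (γ.locallyBoundedVariationOn hγ) trivial trivial trivial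

include hγ in
theorem eVariationOn_Icc {s t : ℝ} (h : s ≤ t) :
    eVariationOn γ.line (Icc s t) = ENNReal.ofReal (γ.arcLength t - γ.arcLength s) := by
  rw [arcLength_sub hγ, variationOnFromTo.eq_of_le _ _ h, univ_inter, ENNReal.ofReal_toReal]
  have := γ.locallyBoundedVariationOn hγ s t trivial trivial
  rwa [univ_inter] at this

include hγ in
theorem monotone_arcLength : Monotone γ.arcLength :=
  monotoneOn_univ.1 (variationOnFromTo.monotoneOn (γ.locallyBoundedVariationOn hγ) trivial)

theorem arcLength_zero (γ : Loop X) : γ.arcLength 0 = 0 := variationOnFromTo.self _ _ _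

include hγ in
theorem eVariationOn_uIcc (s t : ℝ) :
    eVariationOn γ.line (uIcc s t) = ENNReal.ofReal |γ.arcLength t - γ.arcLength s| := by
  rcases le_total s t with h | h
  · rw [uIcc_of_le h, eVariationOn_Icc hγ h, abs_of_nonneg (sub_nonneg.2 (monotone_arcLength hγ h))]
  · rw [uIcc_of_ge h, eVariationOn_Icc hγ h, abs_sub_comm,
      abs_of_nonneg (sub_nonneg.2 (monotone_arcLength hγ h))]

include hγ in
theorem dist_le_arcLength (s t : ℝ) :
    dist (γ.line s) (γ.line t) ≤ |γ.arcLength t - γ.arcLength s| := by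
  have := eVariationOn.edist_le γ.line (left_mem_uIcc (a := s) (b := t)) right_mem_uIcc
  rwa [eVariationOn_uIcc hγ, edist_dist, ENNReal.ofReal_le_ofReal_iff (abs_nonneg _)] at this

include hγ in
theorem arcLength_add_one (t : ℝ) : γ.arcLength (t + 1) = γ.arcLength t + γ.length.toReal := by
  have h1 : ∀ s t : ℝ, s ≤ t → γ.arcLength (t + 1) - γ.arcLength (s + 1) =
      γ.arcLength t - γ.arcLength s := fun s t h => by
    have := eVariationOn_comp_affine γ.line zero_le_one 1 s t h
    simp only [one_mul, line_add_one] at this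
    rw [eVariationOn_Icc hγ h, eVariationOn_Icc hγ (by linarith),
      ENNReal.ofReal_eq_ofReal_iff] at this
    · exact this.symm
    · exact sub_nonneg.2 (monotone_arcLength hγ h)
    · exact sub_nonneg.2 (monotone_arcLength hγ (by linarith))
  have h2 : γ.arcLength 1 = γ.length.toReal := by
    rw [length_eq, eVariationOn_Icc hγ zero_le_one, ENNReal.toReal_ofReal, arcLength_zero, sub_zero]
    exact sub_nonneg.2 (monotone_arcLength hγ zero_le_one)
  have h0 := γ.arcLength_zero
  rcases le_total 0 t with h | h
  · have := h1 0 t h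
    rw [zero_add] at this
    linarith
  · have := h1 t 0 h
    rw [zero_add] at this
    linarith

include hγ in
theorem arcLength_add_int (t : ℝ) (n : ℤ) :
    γ.arcLength (t + n) = γ.arcLength t + n * γ.length.toReal := by
  induction n with
  | zero => simp
  | succ n ih =>
    push_cast at ih ⊢
    rw [← add_assoc, arcLength_add_one hγ, ih]
    ring
  | pred n ih =>
    have := arcLength_add_one hγ (t + ((-n - 1 : ℤ) : ℝ))
    push_cast at ih this ⊢
    rw [show t + (-(n : ℝ) - 1) + 1 = t + -n by ring, ih] at this
    linarith

-- For a continuous curve of bounded variation, the variation over one-sided intervals shrinking to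
-- a point tends to `0`, and it bounds the increments of arc length.
include hγ in
theorem continuous_arcLength : Continuous γ.arcLength := by
  rw [continuous_iff_continuousAt]
  intro x
  set s := Icc (x - 1) (x + 1) with hs
  have hbv : BoundedVariationOn γ.line s := by
    simpa using γ.locallyBoundedVariationOn hγ (x - 1) (x + 1) trivial trivial
  have h1 := hbv.tendsto_eVariationOn_Icc_zero_left (x := x) γ.line.continuous.continuousWithinAt
  have h2 := hbv.tendsto_eVariationOn_Icc_zero_right x γ.line.continuous.continuousWithinAt
  have hsn : s ∈ 𝓝 x := Icc_mem_nhds (by linarith) (by linarith)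
  rw [nhdsWithin_eq_nhds.2 hsn] at h1 h2
  have h3 := (ENNReal.tendsto_toReal (by simp)).comp (h1.add h2)
  rw [ContinuousAt, tendsto_iff_dist_tendsto_zero]
  simp only [add_zero, ENNReal.toReal_zero] at h3
  refine squeeze_zero' (Filter.Eventually.of_forall fun _ => dist_nonneg) ?_ h3
  filter_upwards [hsn] with y hy
  have hfin : ∀ t ⊆ s, eVariationOn γ.line t ≠ ⊤ := fun t ht => hbv.mono ht
  have key : ∀ t ⊆ s, uIcc x y ⊆ t → |γ.arcLength y - γ.arcLength x| ≤ (eVariationOn γ.line t).toReal :=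
    fun t ht hxy => by
      rw [← ENNReal.ofReal_le_iff_le_toReal (hfin t ht), ← eVariationOn_uIcc hγ]
      exact eVariationOn.mono _ hxy
  have hx : x ∈ s := mem_of_mem_nhds hsn
  rw [Real.dist_eq, Function.comp_apply, ENNReal.toReal_add (hfin _ inter_subset_left)
    (hfin _ inter_subset_left)]
  rcases le_total x y with h | h
  · have := key (s ∩ Icc x y) inter_subset_left (by
      rw [uIcc_of_le h]
      exact subset_inter (Icc_subset_Icc hx.1 hy.2) Subset.rfl)
    linarith [ENNReal.toReal_nonneg (a := eVariationOn γ.line (s ∩ Icc y x))]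
  · have := key (s ∩ Icc y x) inter_subset_left (by
      rw [uIcc_of_ge h]
      exact subset_inter (Icc_subset_Icc hy.1 hx.2) Subset.rfl)
    linarith [ENNReal.toReal_nonneg (a := eVariationOn γ.line (s ∩ Icc x y))]

include hγ in
theorem abs_arcLength_le_eVariationOn {w : ℝ → ℝ} {a b : ℝ} (hw : ContinuousOn w (Icc a b))
    (hab : a ≤ b) : ENNReal.ofReal |γ.arcLength (w b) - γ.arcLength (w a)| ≤
      eVariationOn (γ.line ∘ w) (Icc a b) := by
  rw [← eVariationOn_uIcc hγ]
  exact eVariationOn_le_comp' _ hw hab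

/-- The loop given by a map of period `1`. -/
def ofPeriodic (f : C(ℝ, X)) (hf : ∀ t, f (t + 1) = f t) : Loop X where
  toFun := Function.Periodic.lift (f := f) (c := 1) hf
  continuous_toFun := by
    refine (QuotientAddGroup.isQuotientMap_mk (N := AddSubgroup.zmultiples (1 : ℝ))).continuous_iff.2 ?_
    exact f.continuous.congr fun t => (Function.Periodic.lift_coe hf t).symm

theorem line_ofPeriodic (f : C(ℝ, X)) (hf : ∀ t, f (t + 1) = f t) (t : ℝ) :
    (ofPeriodic f hf).line t = f t := Function.Periodic.lift_coe hf t

/-- The loop given by a closed arc of a curve. -/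
noncomputable def ofArc (p : C(ℝ, X)) (a b : ℝ) (h : p a = p b) : Loop X where
  toFun := AddCircle.liftIco 1 0 fun t => p ((b - a) * t + a)
  continuous_toFun := AddCircle.liftIco_continuous (by simp [h]) (by fun_prop)

theorem line_ofArc (p : C(ℝ, X)) (a b : ℝ) (h : p a = p b) {t : ℝ} (ht : t ∈ Icc (0 : ℝ) 1) :
    (ofArc p a b h).line t = p ((b - a) * t + a) := by
  rcases ht.2.eq_or_lt with rfl | ht1
  · have h0 := line_add_one (ofArc p a b h) 0
    rw [zero_add] at h0
    rw [h0, line_apply]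
    refine (AddCircle.liftIco_zero_coe_apply (f := fun t => p ((b - a) * t + a))
      (left_mem_Ico.2 one_pos)).trans ?_
    simp [h]
  · exact AddCircle.liftIco_zero_coe_apply (f := fun t => p ((b - a) * t + a)) ⟨ht.1, ht1⟩

theorem length_ofArc (p : C(ℝ, X)) {a b : ℝ} (h : p a = p b) (hab : a ≤ b) :
    (ofArc p a b h).length = eVariationOn p (Icc a b) := by
  rw [length_eq, eVariationOn.congr fun t ht => line_ofArc p a b h ht,
    eVariationOn_comp_affine p (sub_nonneg.2 hab) a 0 1 zero_le_one]
  simp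

end Loop

end Length

/-! ### Reparametrization by arc length -/

section LengthHomology

variable {X : Type u} [MetricSpace X] (G : Type u) [AddCommGroup G]

theorem Loop.segClass_ofArc (p : C(ℝ, X)) (a b : ℝ) (h : p a = p b) :
    segClass G (Loop.ofArc p a b h).line 0 1 = segClass G p a b := by
  refine pathClass_congr fun t => ?_
  rw [segPath_apply, segPath_apply, Loop.line_ofArc _ _ _ _ (by simp)]
  congr 1
  simp only [smul_eq_mul]
  ring

/-- A loop of finite length is homologous to a loop with the same image which is parametrized
proportionally to arc length. -/
theorem Loop.exists_lipschitz (γ : Loop X) (hγ : γ.length ≠ ⊤) :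
    ∃ γ' : Loop X, range γ' = range γ ∧ γ'.homologyClass G = γ.homologyClass G ∧
      ∀ s t, dist (γ'.line s) (γ'.line t) ≤ γ.length.toReal * |s - t| := by
  rcases (ENNReal.toReal_nonneg (a := γ.length)).eq_or_lt with h0 | hL
  · refine ⟨γ, rfl, rfl, fun s t => ?_⟩
    rw [← h0, zero_mul]
    refine (dist_le_arcLength hγ s t).trans ?_
    have key : ∀ s t : ℝ, γ.arcLength t - γ.arcLength s ≤ 0 := fun s t => by
      obtain ⟨n, hn⟩ := exists_int_gt (t - s)
      have := monotone_arcLength hγ (show t ≤ s + n by linarith)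
      rw [arcLength_add_int hγ, ← h0] at this
      linarith
    have h1 := key s t
    have h2 := key t s
    rw [abs_le]
    constructor <;> linarith
  · set L := γ.length.toReal with hLdef
    have hsurj : Function.Surjective γ.arcLength := by
      intro y
      obtain ⟨n, hn⟩ := exists_int_gt (y / L)
      obtain ⟨m, hm⟩ := exists_int_lt (y / L)
      rw [div_lt_iff₀ hL] at hn
      rw [lt_div_iff₀ hL] at hm
      have h1 := arcLength_add_int hγ 0 n
      have h2 := arcLength_add_int hγ 0 m
      rw [zero_add, arcLength_zero, zero_add] at h1 h2
      have := intermediate_value_uIcc (a := (m : ℝ)) (b := n) (continuous_arcLength hγ).continuousOn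
      rw [h1, h2] at this
      obtain ⟨t, -, ht⟩ := this (Icc_subset_uIcc ⟨hm.le, hn.le⟩)
      exact ⟨t, ht⟩
    -- The right inverse `ρ` of arc length may jump, where `γ` is constant; but `γ ∘ ρ` is
    -- `1`-Lipschitz, hence continuous.
    choose ρ hρ using hsurj
    have hd : ∀ s t, dist (γ.line (ρ s)) (γ.line (ρ t)) ≤ |s - t| := fun s t => by
      have := dist_le_arcLength hγ (ρ s) (ρ t)
      rwa [hρ, hρ, abs_sub_comm] at this
    have hcont : Continuous fun t => γ.line (ρ t) :=
      (LipschitzWith.of_dist_le_mul (K := 1) fun s t => by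
        simpa [Real.dist_eq] using hd s t).continuous
    have hφ : ∀ t, γ.line (ρ (γ.arcLength t)) = γ.line t := fun t => by
      rw [← dist_le_zero]
      refine (dist_le_arcLength hγ _ _).trans ?_
      simp [hρ]
    have hper : ∀ t, γ.line (ρ (t + L)) = γ.line (ρ t) := fun t => by
      rw [← hρ t, ← arcLength_add_one hγ, hφ, hφ, line_add_one]
    let φ : C(ℝ, X) := ⟨fun t => γ.line (ρ t), hcont⟩
    let γ' : Loop X := ofPeriodic (φ.comp ⟨fun t => L * t, by fun_prop⟩) fun t => by
      simp only [φ, ContinuousMap.comp_apply, ContinuousMap.coe_mk, mul_add, mul_one, hper]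
    have hline : ∀ t, γ'.line t = γ.line (ρ (L * t)) := fun t => line_ofPeriodic _ _ t
    refine ⟨γ', ?_, homologyClass_eq_of_segClass_eq ?_, fun s t => ?_⟩
    · rw [← range_line, ← range_line]
      apply Subset.antisymm
      · rintro _ ⟨t, rfl⟩
        exact ⟨_, (hline t).symm⟩
      · rintro _ ⟨t, rfl⟩
        exact ⟨γ.arcLength t / L, by rw [hline, mul_div_cancel₀ _ hL.ne', hφ]⟩
    -- Both loops are `φ` composed with a curve in `ℝ` from `0` to `L`, and such a curve can be
    -- straightened.
    · have h1 : γ'.line = φ.comp ⟨fun t => L * t, by fun_prop⟩ := ContinuousMap.ext hline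
      have h2 : γ.line = φ.comp ⟨γ.arcLength, continuous_arcLength hγ⟩ :=
        ContinuousMap.ext fun t => (hφ t).symm
      rw [h1, h2, segClass_comp, segClass_comp]
      simp only [ContinuousMap.coe_mk, mul_zero, mul_one, arcLength_zero]
      rw [← zero_add (1 : ℝ), arcLength_add_one hγ, arcLength_zero, zero_add]
    · rw [hline, hline]
      refine (hd _ _).trans ?_
      rw [← mul_sub, abs_mul, abs_of_pos hL]

end LengthHomology

/-! ### The retraction onto an isolated loop -/

section Contraction

variable {X : Type*} [MetricSpace X]

/-- A deformation of `S` onto `A` within the ambient space whose end map does not increase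
distances. -/
structure IsShortDeformation (S A : Set X) (F : X × unitInterval → X) : Prop where
  continuousOn : ContinuousOn F (S ×ˢ univ)
  mapsTo : ∀ x ∈ S, ∀ t, F (x, t) ∈ S
  map_zero : ∀ x ∈ S, F (x, 0) = x
  map_one_mem : ∀ x ∈ S, F (x, 1) ∈ A
  map_of_mem : ∀ x ∈ S, x ∈ A → ∀ t, F (x, t) = x
  dist_le : ∀ x ∈ S, ∀ y ∈ S, dist (F (x, 1)) (F (y, 1)) ≤ dist x y

/-- The end map of the deformation decreases distances from points outside `A`. -/
def DecreasesDist (S A : Set X) (F : X × unitInterval → X) : Prop :=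
  ∀ x ∈ S, ∀ y ∈ S, x ∉ A → x ≠ y → dist (F (x, 1)) (F (y, 1)) < dist x y

open Classical in
/-- The extension of a self-map of a subspace by the identity. -/
noncomputable def extendDeformation {S : Set X} (F : C(S × unitInterval, S)) (z : X × unitInterval) : X :=
  if h : z.1 ∈ S then F (⟨z.1, h⟩, z.2) else z.1

theorem extendDeformation_apply {S : Set X} (F : C(S × unitInterval, S)) {x : X} (hx : x ∈ S)
    (t : unitInterval) : extendDeformation F (x, t) = F (⟨x, hx⟩, t) := dif_pos hx

theorem IsDeformationContraction.isShortDeformation {S A : Set X} {F : C(S × unitInterval, S)}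
    (h : IsDeformationContraction ((↑) ⁻¹' A) F) : IsShortDeformation S A (extendDeformation F) where
  continuousOn := by
    rw [continuousOn_iff_continuous_domRestrict]
    have : Continuous fun z : (S ×ˢ univ : Set (X × unitInterval)) =>
        (F (⟨z.1.1, z.2.1⟩, z.1.2) : X) := by fun_prop
    exact this.congr fun z => (extendDeformation_apply F z.2.1 z.1.2).symm
  mapsTo x hx t := by
    rw [extendDeformation_apply F hx]
    exact (F _).2
  map_zero x hx := by rw [extendDeformation_apply F hx, h.map_zero]
  map_one_mem x hx := by
    rw [extendDeformation_apply F hx]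
    exact h.map_one_mem _
  map_of_mem x hx hxA t := by rw [extendDeformation_apply F hx, h.map_of_mem _ hxA]
  dist_le x hx y hy := by
    rw [extendDeformation_apply F hx, extendDeformation_apply F hy]
    have := h.dist_le ⟨x, hx⟩ ⟨y, hy⟩ 0 1 zero_lt_one
    rwa [h.map_zero, h.map_zero] at this

theorem IsStrictDeformationContraction.decreasesDist {S A : Set X} {F : C(S × unitInterval, S)}
    (h : IsStrictDeformationContraction ((↑) ⁻¹' A) F) :
    DecreasesDist S A (extendDeformation F) := by
  intro x hx y hy hxA hxy
  rw [extendDeformation_apply F hx, extendDeformation_apply F hy]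
  have := h.dist_lt ⟨x, hx⟩ ⟨y, hy⟩ hxA (by simpa using hxy) 0 1 zero_lt_one
  rwa [h.map_zero, h.map_zero] at this

end Contraction

namespace IsolatingPair

variable {X : Type*} [MetricSpace X] {α : Loop X} {D₁ D₂ : ℝ} (P : IsolatingPair α D₁ D₂)

/-- The part of `N₂` outside the interior of `N₁`. -/
def collar : Set X := P.N₂ \ annulusInterior P.chart₁

theorem range_subset : range α ⊆ P.N₁ := subset_of_mem_nhdsSet P.mem_nhds

theorem isClosed_collar (hX : IsSurface X) : IsClosed P.collar :=
  P.isClosed₂.sdiff (isOpen_annulusInterior P.chart₁ hX)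

theorem union_collar : P.N₁ ∪ P.collar = P.N₂ := by
  apply Subset.antisymm (union_subset P.subset sdiff_subset)
  intro x hx
  by_cases h : x ∈ annulusInterior P.chart₁
  · exact Or.inl h.1
  · exact Or.inr ⟨hx, h⟩

theorem mem_boundary {x : X} (h₁ : x ∈ P.N₁) (h₂ : x ∈ P.collar) :
    x ∈ annulusBoundary P.chart₁ := by
  by_contra h
  exact h₂.2 ⟨h₁, h⟩

/-- The points `x` and `y` lie both in `N₁` or both in the collar. -/
def SamePart (x y : X) : Prop := x ∈ P.N₁ ∧ y ∈ P.N₁ ∨ x ∈ P.collar ∧ y ∈ P.collar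

theorem SamePart.symm {P : IsolatingPair α D₁ D₂} {x y : X} (h : P.SamePart x y) :
    P.SamePart y x := h.imp And.symm And.symm

/-- A retraction of `N₂` onto the isolated loop which is homotopic to the identity and does not
increase distances in each of the two parts of `N₂`. -/
structure IsRetraction (r : X → X) : Prop where
  continuousOn : ContinuousOn r P.N₂
  mem_range : ∀ x ∈ P.N₂, r x ∈ range α
  map_of_mem : ∀ x ∈ range α, r x = x
  dist_le : ∀ x y, P.SamePart x y → dist (r x) (r y) ≤ dist x y
  homotopic : ∀ β : Loop X, range β ⊆ P.N₂ → ∃ β' : Loop X, (∀ t, β' t = r (β t)) ∧ β.Homotopic β'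

/-- `H` performs `F₁` on the collar and fixes `N₁`; the two agree on the overlap, which lies in
`∂N₁`. Then `F₂` follows. Distances are controlled only within one part, because `F₁` says nothing
about a point of the collar and a point of `N₁`. -/
theorem exists_retraction (hX : IsSurface X) {F₁ F₂ : X × unitInterval → X}
    (h₁ : IsShortDeformation P.collar (annulusBoundary P.chart₁) F₁)
    (h₂ : IsShortDeformation P.N₁ (range α) F₂) :
    ∃ r, P.IsRetraction r ∧ (DecreasesDist P.collar (annulusBoundary P.chart₁) F₁ →
      DecreasesDist P.N₁ (range α) F₂ → ∀ x y, P.SamePart x y → x ∉ range α → x ≠ y →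
        dist (r x) (r y) < dist x y) := by
  classical
  let H : X × unitInterval → X := fun z => if z.1 ∈ P.N₁ then z.1 else F₁ z
  have hH₁ : ∀ x ∈ P.N₁, ∀ t, H (x, t) = x := fun x hx t => if_pos hx
  have hH₂ : ∀ x ∈ P.collar, ∀ t, H (x, t) = F₁ (x, t) := by
    intro x hx t
    by_cases h : x ∈ P.N₁
    · rw [hH₁ x h, h₁.map_of_mem x hx (P.mem_boundary h hx)]
    · exact if_neg h
  have hcont : ContinuousOn H (P.N₂ ×ˢ univ) := by
    rw [← P.union_collar, union_prod]
    refine ContinuousOn.union_of_isClosed ?_ ?_ (P.isClosed₁.prod isClosed_univ)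
      ((P.isClosed_collar hX).prod isClosed_univ)
    · exact continuousOn_fst.congr fun z hz => hH₁ z.1 hz.1 z.2
    · exact h₁.continuousOn.congr fun z hz => hH₂ z.1 hz.1 z.2
  have hmem : ∀ x ∈ P.N₂, ∀ t, H (x, t) ∈ P.N₂ := by
    intro x hx t
    rw [← P.union_collar] at hx ⊢
    rcases hx with hx | hx
    · rw [hH₁ x hx]
      exact Or.inl hx
    · rw [hH₂ x hx]
      exact Or.inr (h₁.mapsTo x hx t)
  have hone : ∀ x ∈ P.N₂, H (x, 1) ∈ P.N₁ := by
    intro x hx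
    rw [← P.union_collar] at hx
    rcases hx with hx | hx
    · rwa [hH₁ x hx]
    · rw [hH₂ x hx]
      exact annulusBoundary_subset _ (h₁.map_one_mem x hx)
  have hzero : ∀ x ∈ P.N₂, H (x, 0) = x := by
    intro x hx
    rw [← P.union_collar] at hx
    rcases hx with hx | hx
    · rw [hH₁ x hx]
    · rw [hH₂ x hx, h₁.map_zero x hx]
  refine ⟨fun x => F₂ (H (x, 1), 1), ⟨?_, ?_, ?_, ?_, ?_⟩, ?_⟩
  · refine h₂.continuousOn.comp ((hcont.comp (by fun_prop) fun x hx => ⟨hx, trivial⟩).prodMk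
      continuousOn_const) fun x hx => ⟨hone x hx, trivial⟩
  · exact fun x hx => h₂.map_one_mem _ (hone x hx)
  · intro x hx
    rw [hH₁ x (P.range_subset hx), h₂.map_of_mem x (P.range_subset hx) hx]
  · rintro x y (⟨hx, hy⟩ | ⟨hx, hy⟩)
    · rw [hH₁ x hx, hH₁ y hy]
      exact h₂.dist_le x hx y hy
    · refine (h₂.dist_le _ (hone x hx.1) _ (hone y hy.1)).trans ?_
      rw [hH₂ x hx, hH₂ y hy]
      exact h₁.dist_le x hx y hy
  · intro β hβ
    have hβ' : ∀ t, β t ∈ P.N₂ := fun t => hβ ⟨t, rfl⟩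
    have c₁ : Continuous fun z : unitInterval × UnitAddCircle => H (β z.2, z.1) :=
      hcont.comp_continuous (by fun_prop) fun z => ⟨hβ' _, trivial⟩
    have c₁' : Continuous fun t => H (β t, 1) :=
      hcont.comp_continuous (by fun_prop) fun z => ⟨hβ' _, trivial⟩
    have c₂ : Continuous fun z : unitInterval × UnitAddCircle => F₂ (H (β z.2, 1), z.1) :=
      h₂.continuousOn.comp_continuous ((c₁'.comp continuous_snd).prodMk continuous_fst)
        fun z => ⟨hone _ (hβ' _), trivial⟩
    have c₂' : Continuous fun t => F₂ (H (β t, 1), 1) :=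
      h₂.continuousOn.comp_continuous (c₁'.prodMk continuous_const)
        fun z => ⟨hone _ (hβ' _), trivial⟩
    refine ⟨⟨_, c₂'⟩, fun t => rfl, ContinuousMap.Homotopic.trans (g := ⟨_, c₁'⟩)
      ⟨⟨⟨_, c₁⟩, fun t => hzero _ (hβ' _), fun t => rfl⟩⟩
      ⟨⟨⟨_, c₂⟩, fun t => h₂.map_zero _ (hone _ (hβ' _)), fun t => rfl⟩⟩⟩
  · intro s₁ s₂
    have hN : ∀ x ∈ P.N₁, ∀ y ∈ P.N₁, x ∉ range α → x ≠ y →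
        dist (F₂ (H (x, 1), 1)) (F₂ (H (y, 1), 1)) < dist x y := fun x hx y hy hxα hxy => by
      rw [hH₁ x hx, hH₁ y hy]
      exact s₂ x hx y hy hxα hxy
    rintro x y (⟨hx, hy⟩ | ⟨hx, hy⟩) hxα hxy
    · exact hN x hx y hy hxα hxy
    -- Two points of the collar are brought strictly closer by `F₁` unless both lie on `∂N₁`; in
    -- that case both lie in `N₁` and `F₂` does it.
    · by_cases hxb : x ∈ annulusBoundary P.chart₁
      · by_cases hyb : y ∈ annulusBoundary P.chart₁
        · exact hN x (annulusBoundary_subset _ hxb) y (annulusBoundary_subset _ hyb) hxα hxy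
        · refine (h₂.dist_le _ (hone x hx.1) _ (hone y hy.1)).trans_lt ?_
          rw [hH₂ x hx, hH₂ y hy, dist_comm, dist_comm x]
          exact s₁ y hy x hx hyb hxy.symm
      · refine (h₂.dist_le _ (hone x hx.1) _ (hone y hy.1)).trans_lt ?_
        rw [hH₂ x hx, hH₂ y hy]
        exact s₁ x hx y hy hxb hxy

theorem exists_isRetraction (hX : IsSurface X) : ∃ r, P.IsRetraction r := by
  obtain ⟨F₁, h₁⟩ := P.outer
  obtain ⟨F₂, h₂⟩ := P.inner
  obtain ⟨r, hr, -⟩ := P.exists_retraction hX h₁.isShortDeformation h₂.isShortDeformation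
  exact ⟨r, hr⟩

theorem IsStrict.exists_isRetraction {P : IsolatingPair α D₁ D₂} (hP : P.IsStrict)
    (hX : IsSurface X) : ∃ r, P.IsRetraction r ∧ ∀ x y, P.SamePart x y → x ∉ range α → x ≠ y →
        dist (r x) (r y) < dist x y := by
  obtain ⟨F₁, h₁⟩ := hP.outer
  obtain ⟨F₂, h₂⟩ := hP.inner
  obtain ⟨r, hr, hs⟩ := P.exists_retraction hX h₁.isShortDeformation h₂.isShortDeformation
  exact ⟨r, hr, hs h₁.decreasesDist h₂.decreasesDist⟩

variable {P}

/-- A curve in `N₂` between the two parts passes through their common boundary. -/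
theorem samePart_or_exists (hX : IsSurface X) {p : ℝ → X} {s t : ℝ} (hp : ContinuousOn p (uIcc s t))
    (hN : ∀ x ∈ uIcc s t, p x ∈ P.N₂) :
    P.SamePart (p s) (p t) ∨ ∃ z ∈ uIcc s t, p z ∈ P.N₁ ∧ p z ∈ P.collar := by
  have hconn := (isPreconnected_uIcc (a := s) (b := t)).image p hp
  have hcov : p '' uIcc s t ⊆ P.N₁ ∪ P.collar := by
    rw [P.union_collar]
    rintro _ ⟨x, hx, rfl⟩
    exact hN x hx
  have hs : p s ∈ p '' uIcc s t := ⟨s, left_mem_uIcc, rfl⟩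
  have ht : p t ∈ p '' uIcc s t := ⟨t, right_mem_uIcc, rfl⟩
  have key := isPreconnected_closed_iff.1 hconn _ _ P.isClosed₁ (P.isClosed_collar hX) hcov
  have fin : (p '' uIcc s t ∩ (P.N₁ ∩ P.collar)).Nonempty →
      ∃ z ∈ uIcc s t, p z ∈ P.N₁ ∧ p z ∈ P.collar := by
    rintro ⟨_, ⟨z, hz, rfl⟩, h⟩
    exact ⟨z, hz, h⟩
  rcases hcov hs with h1 | h1 <;> rcases hcov ht with h2 | h2
  · exact Or.inl (Or.inl ⟨h1, h2⟩)
  · exact Or.inr (fin (key ⟨_, hs, h1⟩ ⟨_, ht, h2⟩))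
  · exact Or.inr (fin (key ⟨_, ht, h2⟩ ⟨_, hs, h1⟩))
  · exact Or.inl (Or.inr ⟨h1, h2⟩)

theorem samePart_of_mem_both {x y : X} (h₁ : x ∈ P.N₁) (h₂ : x ∈ P.collar) (hy : y ∈ P.N₂) :
    P.SamePart x y := by
  rw [← P.union_collar] at hy
  exact hy.imp (fun h => ⟨h₁, h⟩) fun h => ⟨h₂, h⟩

/-- The retraction does not increase the lengths of curves. -/
theorem IsRetraction.eVariationOn_le {r : X → X} (hr : P.IsRetraction r) (hX : IsSurface X)
    {p : ℝ → X} {a b : ℝ} (hp : ContinuousOn p (Icc a b)) (hN : ∀ x ∈ Icc a b, p x ∈ P.N₂) :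
    eVariationOn (r ∘ p) (Icc a b) ≤ eVariationOn p (Icc a b) := by
  have hle : ∀ x y, P.SamePart x y → edist (r x) (r y) ≤ edist x y := fun x y h => by
    rw [edist_dist, edist_dist]
    exact ENNReal.ofReal_le_ofReal (hr.dist_le x y h)
  -- If the endpoints lie in different parts, the arc passes through a point of both parts, which
  -- splits it into two pieces with endpoints in one part each.
  have key : ∀ s ∈ Icc a b, ∀ t ∈ Icc a b, s ≤ t →
      edist (r (p t)) (r (p s)) ≤ eVariationOn p (Icc s t) := by
    intro s hs t ht hst
    have hsub : uIcc s t ⊆ Icc a b := by rw [uIcc_of_le hst]; exact Icc_subset_Icc hs.1 ht.2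
    rcases samePart_or_exists hX (hp.mono hsub) fun x hx => hN x (hsub hx) with h | ⟨z, hz, hz₁, hz₂⟩
    · exact (hle _ _ h.symm).trans
        (eVariationOn.edist_le p (right_mem_Icc.2 hst) (left_mem_Icc.2 hst))
    · have hz' := hz
      rw [uIcc_of_le hst] at hz'
      refine (edist_triangle_right _ _ (r (p z))).trans ?_
      rw [← eVariationOn_Icc_add p hz'.1 hz'.2, add_comm]
      refine add_le_add ?_ ?_
      · exact (hle _ _ (samePart_of_mem_both hz₁ hz₂ (hN s hs)).symm).trans
          (eVariationOn.edist_le p (left_mem_Icc.2 hz'.1) (right_mem_Icc.2 hz'.1))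
      · exact (hle _ _ (samePart_of_mem_both hz₁ hz₂ (hN t ht)).symm).trans
          (eVariationOn.edist_le p (right_mem_Icc.2 hz'.2) (left_mem_Icc.2 hz'.2))
  refine iSup_le ?_
  rintro ⟨n, u, hu, hmem⟩
  calc _ ≤ ∑ i ∈ Finset.range n, eVariationOn p (Icc (u i) (u (i + 1))) :=
        Finset.sum_le_sum fun i _ => key _ (hmem _) _ (hmem _) (hu i.le_succ)
    _ = eVariationOn p (Icc (u 0) (u n)) := eVariationOn.sum' p hu
    _ ≤ _ := eVariationOn.mono p (Icc_subset_Icc (hmem 0).1 (hmem n).2)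

/-- The bound is arc length and not distance, since points of different parts are compared through a
crossing point of `β`. Strictness on the piece that starts at `β.line s` is enough; if the crossing
point coincides with `β.line s`, the two given points already share a part. -/
theorem IsRetraction.dist_lt {r : X → X} (hr : P.IsRetraction r) (hX : IsSurface X)
    (hs : ∀ x y, P.SamePart x y → x ∉ range α → x ≠ y → dist (r x) (r y) < dist x y)
    {β : Loop X} (hβ : β.length ≠ ⊤) (hN : range β ⊆ P.N₂) {s t : ℝ}
    (h : β.line s ∉ range α) (hne : β.line s ≠ β.line t) :
    dist (r (β.line s)) (r (β.line t)) < |β.arcLength t - β.arcLength s| := by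
  have hmem : ∀ t, β.line t ∈ P.N₂ := fun t => hN (by rw [← Loop.range_line]; exact ⟨t, rfl⟩)
  have same : P.SamePart (β.line s) (β.line t) →
      dist (r (β.line s)) (r (β.line t)) < |β.arcLength t - β.arcLength s| := fun h' =>
    (hs _ _ h' h hne).trans_le (Loop.dist_le_arcLength hβ s t)
  rcases samePart_or_exists (P := P) hX (s := s) (t := t) β.line.continuous.continuousOn
    fun x _ => hmem x with h' | ⟨z, hz, hz₁, hz₂⟩
  · exact same h'
  · by_cases hzs : β.line s = β.line z
    · exact same (hzs ▸ samePart_of_mem_both hz₁ hz₂ (hmem t))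
    · have h1 := (hs _ _ (samePart_of_mem_both hz₁ hz₂ (hmem s)).symm h hzs).trans_le
        (Loop.dist_le_arcLength hβ s z)
      have h2 := (hr.dist_le _ _ (samePart_of_mem_both hz₁ hz₂ (hmem t))).trans
        (Loop.dist_le_arcLength hβ z t)
      have h3 := dist_triangle (r (β.line s)) (r (β.line z)) (r (β.line t))
      have hm := Loop.monotone_arcLength hβ
      rcases le_total s t with hst | hst
      · rw [uIcc_of_le hst] at hz
        rw [abs_of_nonneg (sub_nonneg.2 (hm hz.1))] at h1
        rw [abs_of_nonneg (sub_nonneg.2 (hm hz.2))] at h2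
        rw [abs_of_nonneg (sub_nonneg.2 (hm hst))]
        linarith
      · rw [uIcc_of_ge hst] at hz
        rw [abs_of_nonpos (sub_nonpos.2 (hm hz.2))] at h1
        rw [abs_of_nonpos (sub_nonpos.2 (hm hz.1))] at h2
        rw [abs_of_nonpos (sub_nonpos.2 (hm hst))]
        linarith

theorem mem_N₂_of_dist_le (hX : IsGeodesicSpace X) {x y : X} (hx : x ∈ P.N₁)
    (hxy : dist x y ≤ D₂) : y ∈ P.N₂ := by
  have hlt : ∀ y, dist x y < D₂ → y ∈ P.N₂ := fun y h =>
    P.thickening_subset (Metric.mem_thickening_iff.2 ⟨x, hx, by rwa [dist_comm]⟩)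
  rcases (dist_nonneg (x := x) (y := y)).eq_or_lt with h0 | hpos
  · rw [dist_eq_zero.1 h0.symm] at hx
    exact P.subset hx
  obtain ⟨g, g0, g1, hg⟩ := hX x y
  rw [← P.isClosed₂.closure_eq, Metric.mem_closure_iff]
  intro ε hε
  set d := dist x y
  -- The thickening only contains points at distance less than `D₂`. A point at distance exactly
  -- `D₂` is a limit of points slightly earlier on the geodesic, and `N₂` is closed.
  set τ := d - min (ε / 2) d with hτ
  have hm0 : 0 < min (ε / 2) d := lt_min (by linarith) hpos
  have hm1 : min (ε / 2) d ≤ d := min_le_right _ _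
  have hm2 : min (ε / 2) d ≤ ε / 2 := min_le_left _ _
  have hτm : τ ∈ Icc 0 d := ⟨by linarith, by linarith⟩
  refine ⟨g τ, hlt _ ?_, ?_⟩
  · have := hg 0 (left_mem_Icc.2 hpos.le) τ hτm
    rw [g0, zero_sub, abs_neg, abs_of_nonneg hτm.1] at this
    linarith
  · have := hg d (right_mem_Icc.2 hpos.le) τ hτm
    rw [g1, abs_of_nonneg (by linarith)] at this
    linarith

end IsolatingPair

/-! ### Geodesics as curves on the line -/

section Geodesic

variable {X : Type*} [MetricSpace X]

/-- A geodesic extended to a curve on the whole real line. -/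
theorem IsGeodesicSpace.exists_curve (hX : IsGeodesicSpace X) (x y : X) :
    ∃ p : C(ℝ, X), p 0 = x ∧ p (dist x y) = y ∧
      ∀ s ∈ Icc 0 (dist x y), ∀ t ∈ Icc 0 (dist x y), dist (p s) (p t) = |s - t| := by
  obtain ⟨g, g0, g1, hg⟩ := hX x y
  have hd : 0 ≤ dist x y := dist_nonneg
  have hc : Continuous fun t : Icc 0 (dist x y) => g t :=
    (Isometry.of_dist_eq fun (s t : Icc 0 (dist x y)) => hg s s.2 t t.2).continuous
  refine ⟨⟨fun t => g (projIcc 0 (dist x y) hd t), hc.comp continuous_projIcc⟩, ?_, ?_, ?_⟩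
  · simp [g0]
  · simp [g1]
  · intro s hs t ht
    simp only [ContinuousMap.coe_mk]
    rw [projIcc_of_mem _ hs, projIcc_of_mem _ ht, hg s hs t ht]

theorem eVariationOn_le_of_lipschitz {p : ℝ → X} {K : ℝ} (hK : 0 ≤ K) {a b : ℝ}
    (hp : ∀ s ∈ Icc a b, ∀ t ∈ Icc a b, dist (p s) (p t) ≤ K * |s - t|) :
    eVariationOn p (Icc a b) ≤ ENNReal.ofReal (K * (b - a)) := by
  have h1 : LipschitzOnWith K.toNNReal p (Icc a b) := LipschitzOnWith.of_dist_le_mul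
    fun s hs t ht => by rw [Real.coe_toNNReal K hK, Real.dist_eq]; exact hp s hs t ht
  have := h1.comp_eVariationOn_le (g := id) (s := Icc a b) (mapsTo_id _)
  rw [Function.comp_id, eVariationOn_id_Icc] at this
  refine this.trans ?_
  rw [ENNReal.ofReal_mul hK]
  rfl

end Geodesic

/-! ### Loops near an isolated loop -/

namespace Loop

variable {X : Type*} [MetricSpace X] {α : Loop X} (hα : Function.Injective α)

include hα in
/-- A curve in the image of a simple loop lifts to the real line. -/
theorem exists_lift (q : C(ℝ, X)) (hq : ∀ t, q t ∈ range α) {u : ℝ} (hu : α.line u = q 0) :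
    ∃ w : C(ℝ, ℝ), w 0 = u ∧ ∀ t, α.line (w t) = q t := by
  have he : IsClosedEmbedding α := α.continuous.isClosedEmbedding hα
  choose v hv using hq
  have hvc : Continuous v := by
    rw [he.isInducing.continuous_iff]
    exact q.continuous.congr fun t => (hv t).symm
  have h0 : (u : UnitAddCircle) = v 0 := hα (by rw [hv, ← hu, line_apply])
  obtain ⟨w, ⟨hw0, hw⟩, -⟩ := (AddCircle.isCoveringMap_coe (1 : ℝ)).existsUnique_continuousMap_lifts
    ⟨v, hvc⟩ 0 u h0
  refine ⟨w, hw0, fun t => ?_⟩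
  rw [line_apply, ← hv t]
  exact congrArg α (congrFun hw t)

include hα in
theorem line_eq_iff {s t : ℝ} : α.line s = α.line t ↔ ∃ n : ℤ, t = s + n := by
  rw [line_apply, line_apply, hα.eq_iff, eq_comm, ← sub_eq_zero, ← AddCircle.coe_sub,
    AddCircle.coe_eq_zero_iff]
  simp only [zsmul_eq_mul, mul_one]
  exact exists_congr fun n => ⟨fun h => by linarith, fun h => by linarith⟩

include hα in
/-- A loop in the image of a simple loop lifts to an equivariant map of the real line. -/
theorem exists_equivariant_lift (β : Loop X) (hβ : ∀ t, β t ∈ range α) :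
    ∃ (w : C(ℝ, ℝ)) (n : ℤ), (∀ t, α.line (w t) = β.line t) ∧ ∀ t, w (t + 1) = w t + n := by
  have hβ' : ∀ t, β.line t ∈ range α := fun t => hβ t
  obtain ⟨u, hu⟩ : β.line 0 ∈ range α.line := by rw [range_line]; exact hβ' 0
  obtain ⟨w, -, hw⟩ := exists_lift hα β.line hβ' hu
  obtain ⟨n, hn⟩ := (line_eq_iff hα (s := w 0) (t := w (0 + 1))).1 (by
    rw [hw, hw, line_add_one])
  refine ⟨w, n, hw, fun t => ?_⟩
  have := (AddCircle.isCoveringMap_coe (1 : ℝ)).eq_of_comp_eq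
    (g₁ := fun t => w (t + 1)) (g₂ := fun t => w t + n) (by fun_prop) (by fun_prop) (by
      ext t
      apply hα
      change α.line (w (t + 1)) = α.line (w t + n)
      rw [line_add_int, hw, hw, line_add_one]) 0 hn
  exact congrFun this t

end Loop

namespace IsolatingPair

variable {X : Type*} [MetricSpace X] {α : Loop X} {D₁ D₂ : ℝ} {P : IsolatingPair α D₁ D₂}

/-- An isolated simple loop is geodesic: its arcs of at most half its length are geodesics. -/
theorem IsRetraction.arcLength_le_dist {r : X → X} (hr : P.IsRetraction r)
    (hX : IsGeodesicSurface X) (hα : Function.Injective α) (hfin : α.length ≠ ⊤)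
    (hD₂ : α.length.toReal / 2 ≤ D₂) {u v : ℝ}
    (h : |α.arcLength v - α.arcLength u| ≤ α.length.toReal / 2) :
    |α.arcLength v - α.arcLength u| ≤ dist (α.line u) (α.line v) := by
  set d := dist (α.line u) (α.line v) with hd
  have hd0 : 0 ≤ d := dist_nonneg
  obtain ⟨p, p0, p1, hp⟩ := hX.geodesic.exists_curve (α.line u) (α.line v)
  have hdle : d ≤ D₂ := (Loop.dist_le_arcLength hfin u v).trans (h.trans hD₂)
  have huα : α.line u ∈ P.N₁ := P.range_subset ⟨_, rfl⟩
  have hN : ∀ x ∈ Icc 0 d, p x ∈ P.N₂ := fun x hx => by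
    refine mem_N₂_of_dist_le hX.geodesic huα ?_
    rw [← p0, hp 0 (left_mem_Icc.2 hd0) x hx, zero_sub, abs_neg, abs_of_nonneg hx.1]
    exact hx.2.trans hdle
  have hlen : eVariationOn p (Icc 0 d) ≤ ENNReal.ofReal d := by
    simpa using eVariationOn_le_of_lipschitz (p := p) zero_le_one (a := 0) (b := d)
      fun s hs t ht => by rw [hp s hs t ht, one_mul]
  -- A geodesic between the two points stays within `D₂` of `α`, so it can be retracted into `α`
  -- without gaining length. Its lift runs from `u` to some `v + n`.
  let q : C(ℝ, X) := ⟨fun t => r (p (projIcc 0 d hd0 t)),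
    hr.continuousOn.comp_continuous (by fun_prop) fun t => hN _ (projIcc 0 d hd0 t).2⟩
  have hqp : ∀ t ∈ Icc 0 d, q t = r (p t) := fun t ht => by
    simp only [q, ContinuousMap.coe_mk]
    rw [projIcc_of_mem _ ht]
  have q0 : q 0 = α.line u := by
    rw [hqp 0 (left_mem_Icc.2 hd0), p0, hr.map_of_mem (α.line u) ⟨_, rfl⟩]
  have q1 : q d = α.line v := by
    rw [hqp d (right_mem_Icc.2 hd0), p1, hr.map_of_mem (α.line v) ⟨_, rfl⟩]
  obtain ⟨w, w0, hw⟩ := Loop.exists_lift hα q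
    (fun t => hr.mem_range _ (hN _ (projIcc 0 d hd0 t).2)) q0.symm
  obtain ⟨n, hn⟩ := (Loop.line_eq_iff hα (s := v) (t := w d)).1 (by rw [hw, q1])
  have key : |α.arcLength (w d) - α.arcLength (w 0)| ≤ d := by
    rw [← ENNReal.ofReal_le_ofReal_iff hd0]
    refine (Loop.abs_arcLength_le_eVariationOn hfin w.continuous.continuousOn hd0).trans ?_
    refine le_trans (le_of_eq ?_) ((hr.eVariationOn_le hX.surface p.continuous.continuousOn
      hN).trans hlen)
    exact eVariationOn.congr fun t ht => (hw t).trans (hqp t ht)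
  rw [hn, w0, Loop.arcLength_add_int hfin] at key
  refine le_trans ?_ key
  set x := α.arcLength v - α.arcLength u with hx
  set L := α.length.toReal
  have hL : 0 ≤ L := ENNReal.toReal_nonneg
  rw [show α.arcLength v + n * L - α.arcLength u = x + n * L by rw [hx]; ring]
  -- Since `|x| ≤ L / 2`, any translate `x + n * L` with `n ≠ 0` has absolute value at least `L -
  -- |x| ≥ |x|`.
  rcases eq_or_ne n 0 with rfl | hn0
  · simp
  · have h1 : (1 : ℝ) ≤ |(n : ℝ)| := by exact_mod_cast Int.one_le_abs hn0
    have h2 : L ≤ |n * L| := by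
      rw [abs_mul, abs_of_nonneg hL]
      nlinarith
    have h3 := abs_sub_abs_le_abs_sub (n * L) (-x)
    rw [abs_neg, sub_neg_eq_add, add_comm _ x] at h3
    linarith

/-- Two points of `β` are joined by two arcs of total length `|β|`, so one arc has length at most
`|β| / 2 ≤ D₂`. -/
theorem range_subset_N₂ (hX : IsGeodesicSpace X) {β : Loop X} (hfin : β.length ≠ ⊤)
    (hD₂ : β.length.toReal / 2 ≤ D₂) (h : ¬ Disjoint (range β) P.N₁) : range β ⊆ P.N₂ := by
  obtain ⟨x, hx, hxN⟩ := not_disjoint_iff.1 h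
  rw [← Loop.range_line] at hx ⊢
  obtain ⟨s, rfl⟩ := hx
  rintro _ ⟨t, rfl⟩
  set t' := t + (-⌊t - s⌋ : ℤ) with ht'
  have e : β.line t = β.line t' := (β.line_add_int t _).symm
  have h1 : s ≤ t' := by
    have := Int.floor_le (t - s)
    push_cast [ht']
    linarith
  have h2 : t' ≤ s + 1 := by
    have := Int.lt_floor_add_one (t - s)
    push_cast [ht']
    linarith
  refine mem_N₂_of_dist_le hX hxN (le_trans ?_ hD₂)
  rw [e]
  have d1 := Loop.dist_le_arcLength hfin s t'
  have d2 := Loop.dist_le_arcLength hfin (s + 1) t'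
  rw [Loop.line_add_one] at d2
  rw [abs_of_nonneg (sub_nonneg.2 (Loop.monotone_arcLength hfin h1))] at d1
  rw [abs_of_nonpos (sub_nonpos.2 (Loop.monotone_arcLength hfin h2)),
    Loop.arcLength_add_one hfin] at d2
  linarith

end IsolatingPair

/-! ### Loops that meet the isolating neighbourhood -/

namespace IsolatingPair

variable {X : Type u} [MetricSpace X] {α : Loop X} {D₁ D₂ : ℝ} {P : IsolatingPair α D₁ D₂}

/-- A loop in `N₂` is null-homologous, or its retraction to the isolated loop winds around it. -/
theorem IsRetraction.homologyClass_eq_zero_or {r : X → X} (hr : P.IsRetraction r)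
    (hX : IsSurface X) (hα : Function.Injective α) (hfin : α.length ≠ ⊤)
    {β : Loop X} (hβ : β.length ≠ ⊤) (hN : range β ⊆ P.N₂) (G : Type u) [AddCommGroup G] :
    β.homologyClass G = 0 ∨ ∃ w : C(ℝ, ℝ), (∀ t, α.line (w t) = r (β.line t)) ∧
      (∀ t, α.length.toReal ≤ |α.arcLength (w (t + 1)) - α.arcLength (w t)|) ∧
      (∃ n : ℤ, n ≠ 0 ∧ w 1 = w 0 + n) ∧
      ∀ s t, s ≤ t → |α.arcLength (w t) - α.arcLength (w s)| ≤ β.arcLength t - β.arcLength s := by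
  obtain ⟨β', hβ', hhom⟩ := hr.homotopic β hN
  obtain ⟨w, n, hw, hwn⟩ := Loop.exists_equivariant_lift hα β' fun t => by
    rw [hβ']
    exact hr.mem_range _ (hN ⟨t, rfl⟩)
  -- Here `n` is the degree of the retracted loop. In degree `0` the lift `w` is closed, and
  -- straightening it gives a constant curve.
  rcases eq_or_ne n 0 with rfl | hn
  · left
    rw [Loop.homologyClass_eq_of_homotopic hhom]
    apply Loop.homologyClass_eq_zero
    have h1 : β'.line = α.line.comp w := ContinuousMap.ext fun t => (hw t).symm
    have h2 := hwn 0
    rw [zero_add, Int.cast_zero, add_zero] at h2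
    rw [h1, segClass_comp, h2, segClass_self]
  · right
    refine ⟨w, fun t => by rw [hw]; exact hβ' _, fun t => ?_, ⟨n, hn, ?_⟩, fun s t hst => ?_⟩
    · have hL : 0 ≤ α.length.toReal := ENNReal.toReal_nonneg
      rw [hwn, Loop.arcLength_add_int hfin, add_sub_cancel_left, abs_mul, abs_of_nonneg hL]
      have h1 : (1 : ℝ) ≤ |(n : ℝ)| := by exact_mod_cast Int.one_le_abs hn
      nlinarith
    · simpa using hwn 0
    · rw [← ENNReal.ofReal_le_ofReal_iff (sub_nonneg.2 (Loop.monotone_arcLength hβ hst)),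
        ← Loop.eVariationOn_Icc hβ hst]
      refine (Loop.abs_arcLength_le_eVariationOn hfin w.continuous.continuousOn hst).trans ?_
      refine le_trans (le_of_eq ?_) (hr.eVariationOn_le hX β.line.continuous.continuousOn
        fun t _ => hN ⟨_, rfl⟩)
      exact eVariationOn.congr fun t _ => (hw t).trans (hβ' _)

/-- Loops which are shorter than an isolated loop and meet its neighbourhood are
null-homologous. -/
theorem homologyClass_eq_zero_of_length_lt (P : IsolatingPair α D₁ D₂) (hX : IsGeodesicSurface X)
    (hα : Function.Injective α) (hfin : α.length ≠ ⊤) (hD₂ : α.length.toReal / 2 ≤ D₂)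
    {β : Loop X} (hβ : β.length < α.length) (hN : ¬ Disjoint (range β) P.N₁)
    (G : Type u) [AddCommGroup G] : β.homologyClass G = 0 := by
  have hβfin : β.length ≠ ⊤ := hβ.ne_top
  have hlt : β.length.toReal < α.length.toReal := ENNReal.toReal_strict_mono hfin hβ
  obtain ⟨r, hr⟩ := P.exists_isRetraction hX.surface
  rcases hr.homologyClass_eq_zero_or hX.surface hα hfin hβfin
    (range_subset_N₂ hX.geodesic hβfin (by linarith) hN) G with h | ⟨w, -, h1, -, h2⟩
  · exact h
  · have h3 := h1 0
    have h4 := h2 0 (0 + 1) (by simp)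
    rw [Loop.arcLength_add_one hβfin] at h4
    linarith

/-- Loops which are not longer than a strictly isolated loop, different from it, and meet its
neighbourhood, are null-homologous. -/
theorem IsStrict.homologyClass_eq_zero (hP : P.IsStrict) (hX : IsGeodesicSurface X)
    (hα : Function.Injective α) (hfin : α.length ≠ ⊤) (hD₂ : α.length.toReal / 2 ≤ D₂)
    {β : Loop X} (hβ : β.length ≤ α.length) (hne : range β ≠ range α)
    (hN : ¬ Disjoint (range β) P.N₁) (G : Type u) [AddCommGroup G] : β.homologyClass G = 0 := by
  have hβfin : β.length ≠ ⊤ := ne_top_of_le_ne_top hfin hβ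
  have hle : β.length.toReal ≤ α.length.toReal := ENNReal.toReal_mono hfin hβ
  obtain ⟨r, hr, hstrict⟩ := hP.exists_isRetraction hX.surface
  have hN₂ : range β ⊆ P.N₂ := range_subset_N₂ hX.geodesic hβfin (by linarith) hN
  rcases hr.homologyClass_eq_zero_or hX.surface hα hfin hβfin hN₂ G with
    h | ⟨w, hw, h1, ⟨n, hn, hwn⟩, h2⟩
  · exact h
  exfalso
  have hLpos : 0 < α.length.toReal := by
    rcases (ENNReal.toReal_nonneg (a := α.length)).eq_or_lt with h0 | h0
    · exfalso
      -- A loop of length `0` would take the same value at `0` and `1 / 2`, against injectivity.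
      have h3 := Loop.arcLength_add_one hfin 0
      rw [zero_add, ← h0, add_zero] at h3
      have h4 := Loop.dist_le_arcLength hfin 0 (1 / 2)
      have h5 := Loop.monotone_arcLength hfin (show (0 : ℝ) ≤ 1 / 2 by norm_num)
      have h6 := Loop.monotone_arcLength hfin (show (1 / 2 : ℝ) ≤ 1 by norm_num)
      rw [show α.arcLength (1 / 2) = α.arcLength 0 by linarith, sub_self, abs_zero] at h4
      obtain ⟨m, hm⟩ := (Loop.line_eq_iff hα).1 (dist_le_zero.1 h4)
      have h7 : (2 * m : ℤ) = 1 := by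
        have : (2 * m : ℝ) = 1 := by linarith
        exact_mod_cast this
      omega
    · exact h0
  -- a point of `β` outside `α`
  obtain ⟨s₀, hs₀⟩ : ∃ s₀, β.line s₀ ∉ range α := by
    by_contra! hall
    have hfix : ∀ t, α.line (w t) = β.line t := fun t => by rw [hw, hr.map_of_mem _ (hall t)]
    apply hne
    apply Subset.antisymm
    · rw [← Loop.range_line β]
      rintro _ ⟨t, rfl⟩
      exact hall t
    · rw [← Loop.range_line α, ← Loop.range_line β]
      rintro _ ⟨x, rfl⟩
      -- The endpoints of the lift differ by a nonzero integer, so the interval between them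
      -- contains an integer translate of every `x`: a loop inside `α` of nonzero degree covers `α`.
      have hmem : ∃ m : ℤ, x + m ∈ uIcc (w 0) (w 1) := by
        set a := min (w 0) (w 1) with ha
        refine ⟨-⌊x - a⌋, ?_⟩
        have f1 := Int.floor_le (x - a)
        have f2 := Int.lt_floor_add_one (x - a)
        have h3 : a + 1 ≤ max (w 0) (w 1) := by
          have h4 : max (w 0) (w 1) - min (w 0) (w 1) = |(n : ℝ)| := by
            rw [max_sub_min_eq_abs, hwn, add_sub_cancel_left]
          have h5 : (1 : ℝ) ≤ |(n : ℝ)| := by exact_mod_cast Int.one_le_abs hn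
          linarith
        push_cast
        exact ⟨by change a ≤ _; linarith, by change _ ≤ max (w 0) (w 1); linarith⟩
      obtain ⟨m, hm⟩ := hmem
      obtain ⟨t, -, ht⟩ := intermediate_value_uIcc w.continuous.continuousOn hm
      exact ⟨t, by rw [← hfix, ht, Loop.line_add_int]⟩
  -- a parameter where `β` leaves this point
  let T : Set ℝ := β.line ⁻¹' {β.line s₀}
  have hTne : T ≠ univ := fun hT => by
    have hconst : ∀ t, β.line t = β.line s₀ := fun t => (hT ▸ mem_univ t : t ∈ T)
    have h3 : β.length = 0 := eVariationOn.constant_on (by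
      rintro _ ⟨x, -, rfl⟩ _ ⟨y, -, rfl⟩
      exact (hconst x).trans (hconst y).symm)
    have h4 := h1 0
    have h5 := h2 0 (0 + 1) (by simp)
    rw [Loop.arcLength_add_one hβfin, h3, ENNReal.toReal_zero] at h5
    linarith
  have hTcl : IsClosed T := isClosed_singleton.preimage β.line.continuous
  obtain ⟨s, hsT⟩ : (frontier T).Nonempty := by
    rw [nonempty_frontier_iff]
    exact ⟨⟨s₀, rfl⟩, hTne⟩
  have hs : β.line s = β.line s₀ := hTcl.frontier_subset hsT
  have hsα : β.line s ∉ range α := hs ▸ hs₀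
  have hc : Continuous fun t => |α.arcLength (w t) - α.arcLength (w s)| :=
    (((Loop.continuous_arcLength hfin).comp w.continuous).sub continuous_const).abs
  -- Close to `s` the lift moves by less than half of `|α|`, so its displacement is a distance in
  -- `X` and the strict decrease of distances applies to it.
  have hU : {t | |α.arcLength (w t) - α.arcLength (w s)| < α.length.toReal / 2} ∩ Ioo (s - 1) (s + 1)
      ∈ 𝓝 s := by
    refine Filter.inter_mem ((isOpen_Iio.preimage hc).mem_nhds ?_)
      (Ioo_mem_nhds (by linarith) (by linarith))
    simpa using hLpos
  have hsc : s ∈ closure Tᶜ := by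
    rw [frontier_eq_closure_inter_closure] at hsT
    exact hsT.2
  obtain ⟨t, ⟨htL, ht1⟩, htT⟩ := mem_closure_iff_nhds.1 hsc _ hU
  have htne : β.line s ≠ β.line t := fun h => htT (h.symm.trans hs)
  have hst := hr.dist_lt hX.surface hstrict hβfin hN₂ hsα htne
  have hge := hr.arcLength_le_dist hX hα hfin hD₂ (u := w s) (v := w t) htL.le
  rw [hw, hw] at hge
  have hlt := hge.trans_lt hst
  -- Between `s` and `t` the lift moves strictly less than `β`, and on the rest of the period at
  -- most as much. Altogether it moves less than `|β| ≤ |α|`, while nonzero degree requires at least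
  -- `|α|`.
  rcases le_total s t with h | h
  · have h3 := h1 s
    have h4 := h2 t (s + 1) ht1.2.le
    rw [Loop.arcLength_add_one hβfin] at h4
    rw [abs_of_nonneg (a := β.arcLength t - β.arcLength s)
      (sub_nonneg.2 (Loop.monotone_arcLength hβfin h))] at hlt
    have h5 := abs_sub_le (α.arcLength (w (s + 1))) (α.arcLength (w t)) (α.arcLength (w s))
    linarith
  · have h3 := h1 t
    have h4 := h2 s (t + 1) (by linarith [ht1.1])
    rw [Loop.arcLength_add_one hβfin] at h4
    rw [abs_of_nonpos (a := β.arcLength t - β.arcLength s)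
      (sub_nonpos.2 (Loop.monotone_arcLength hβfin h)), abs_sub_comm] at hlt
    have h5 := abs_sub_le (α.arcLength (w (t + 1))) (α.arcLength (w s)) (α.arcLength (w t))
    linarith

end IsolatingPair

/-! ### Concatenation of curves -/

section Concat

variable {X : Type u} [TopologicalSpace X]

/-- The curve which follows `p` up to the parameter `b`, and then `q` from the parameter `c`. -/
noncomputable def concat (p q : C(ℝ, X)) (b c : ℝ) (h : p b = q c) : C(ℝ, X) where
  toFun t := if t ≤ b then p t else q (t - b + c)
  continuous_toFun := Continuous.if_le (by fun_prop) (by fun_prop) continuous_id continuous_const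
    (by rintro _ rfl; simpa using h)

variable {p q : C(ℝ, X)} {b c : ℝ} (h : p b = q c)

theorem concat_of_le {t : ℝ} (ht : t ≤ b) : concat p q b c h t = p t := if_pos ht

theorem concat_of_ge {t : ℝ} (ht : b ≤ t) : concat p q b c h t = q (t - b + c) := by
  rcases ht.eq_or_lt with rfl | ht
  · rw [concat_of_le h le_rfl, h, sub_self, zero_add]
  · exact if_neg ht.not_ge

theorem concat_mem {S : Set X} {a d : ℝ} (hp : ∀ t ∈ Icc a b, p t ∈ S) (hq : ∀ t ∈ Icc c d, q t ∈ S)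
    {t : ℝ} (ht : t ∈ Icc a (d - c + b)) : concat p q b c h t ∈ S := by
  rcases le_total t b with htb | htb
  · rw [concat_of_le h htb]
    exact hp t ⟨ht.1, htb⟩
  · rw [concat_of_ge h htb]
    exact hq _ ⟨by linarith, by linarith [ht.2]⟩

variable {G : Type u} [AddCommGroup G]

theorem segClass_congr {f g : C(ℝ, X)} {a b c d : ℝ} (hab : a ≤ b) (hd : d - c = b - a)
    (hfg : ∀ t ∈ Icc a b, f t = g (t - a + c)) : segClass G f a b = segClass G g c d := by
  refine pathClass_congr fun t => ?_
  obtain ⟨t, ht0, ht1⟩ := t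
  rw [segPath_apply, segPath_apply]
  simp only [smul_eq_mul]
  rw [hfg]
  · congr 1
    linear_combination (-t) * hd
  · constructor <;> nlinarith

theorem segClass_concat {a d : ℝ} (hab : a ≤ b) (hcd : c ≤ d) :
    segClass G (concat p q b c h) a (d - c + b) = segClass G p a b + segClass G q c d := by
  rw [← segClass_add _ a b]
  congr 1
  · exact segClass_congr hab rfl fun t ht => by rw [concat_of_le h ht.2, sub_add_cancel]
  · exact segClass_congr (by linarith) (by ring) fun t ht => concat_of_ge h ht.1

/-- The curve run backwards from the parameter `d`. -/
def reverse (q : C(ℝ, X)) (d : ℝ) : C(ℝ, X) := q.comp ⟨fun t => d - t, by fun_prop⟩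

theorem reverse_apply (q : C(ℝ, X)) (d t : ℝ) : reverse q d t = q (d - t) := rfl

theorem segClass_reverse (q : C(ℝ, X)) (c d : ℝ) :
    segClass G (reverse q d) 0 (d - c) = -segClass G q c d := by
  rw [← segClass_symm]
  refine pathClass_congr fun t => ?_
  rw [segPath_apply, segPath_apply, reverse_apply]
  congr 1
  simp only [smul_eq_mul]
  ring

end Concat

theorem eVariationOn_concat {X : Type u} [MetricSpace X] {p q : C(ℝ, X)} {b c : ℝ} (h : p b = q c)
    {a d : ℝ} (hab : a ≤ b) (hcd : c ≤ d) : eVariationOn (concat p q b c h) (Icc a (d - c + b)) =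
      eVariationOn p (Icc a b) + eVariationOn q (Icc c d) := by
  rw [← eVariationOn_Icc_add _ hab (by linarith)]
  congr 1
  · exact eVariationOn.congr fun t ht => concat_of_le h ht.2
  · have h1 := eVariationOn_comp_affine q zero_le_one (c - b) b (d - c + b) (by linarith)
    rw [show 1 * b + (c - b) = c by ring, show 1 * (d - c + b) + (c - b) = d by ring] at h1
    rw [← h1]
    exact eVariationOn.congr fun t ht => (concat_of_ge h ht.1).trans (by congr 1; ring)

/-! ### Small loops -/

section Small

variable {X : Type u} [MetricSpace X] (G : Type u) [AddCommGroup G]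

/-- Points of a surface have neighbourhoods in which loops are null-homotopic. -/
theorem IsSurface.exists_isOpen_homotopic (hX : IsSurface X) (x : X) :
    ∃ U : Set X, IsOpen U ∧ x ∈ U ∧ ∀ γ : Loop X, range γ ⊆ U → γ.Homotopic (.const _ x) := by
  obtain ⟨e, he⟩ := hX x
  obtain ⟨O, hO, hOe⟩ := isOpen_induced_iff.1 e.open_target
  have hxO : (e x).1 ∈ O := by
    have : e x ∈ Subtype.val ⁻¹' O := hOe ▸ e.map_source he
    exact this
  obtain ⟨ρ, hρ, hρO⟩ := Metric.isOpen_iff.1 hO _ hxO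
  refine ⟨e.source ∩ e ⁻¹' (Subtype.val ⁻¹' Metric.ball (e x).1 ρ),
    e.isOpen_inter_preimage (Metric.isOpen_ball.preimage continuous_subtype_val),
    ⟨he, Metric.mem_ball_self hρ⟩, fun γ hγ => ?_⟩
  have hγ' : ∀ t, γ t ∈ e.source ∩ e ⁻¹' (Subtype.val ⁻¹' Metric.ball (e x).1 ρ) :=
    fun t => hγ ⟨t, rfl⟩
  have hc : Continuous fun t => e (γ t) :=
    e.continuousOn.comp_continuous γ.continuous fun t => (hγ' t).1
  -- The straight-line contraction to `e x` in the chart; convexity keeps it in the half-plane and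
  -- in the ball.
  let k : unitInterval × UnitAddCircle → EuclideanHalfSpace 2 := fun z =>
    ⟨(1 - (z.1 : ℝ)) • (e (γ z.2)).1 + (z.1 : ℝ) • (e x).1, by
      have h1 : 0 ≤ (e (γ z.2)).1 0 := (e (γ z.2)).2
      have h2 : 0 ≤ (e x).1 0 := (e x).2
      have h3 := z.1.2.1
      have h4 := sub_nonneg.2 z.1.2.2
      simp only [PiLp.add_apply, PiLp.smul_apply, smul_eq_mul]
      positivity⟩
  have hk : Continuous k := by
    refine Continuous.subtype_mk ?_ _
    have : Continuous fun z : unitInterval × UnitAddCircle => (e (γ z.2)).1 :=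
      continuous_subtype_val.comp (hc.comp continuous_snd)
    fun_prop
  have hkt : ∀ z, k z ∈ e.target := fun z => by
    rw [← hOe]
    refine hρO ((convex_ball (e x).1 ρ) (hγ' z.2).2 (Metric.mem_ball_self hρ)
      (sub_nonneg.2 z.1.2.2) z.1.2.1 (by ring))
  refine ⟨⟨⟨fun z => e.symm (k z), e.symm.continuousOn.comp_continuous hk hkt⟩, fun t => ?_,
    fun t => ?_⟩⟩
  · have : k (0, t) = e (γ t) := Subtype.ext (by simp [k])
    change e.symm (k (0, t)) = _
    rw [this, e.left_inv (hγ' t).1]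
  · have : k (1, t) = e x := Subtype.ext (by simp [k])
    change e.symm (k (1, t)) = _
    rw [this, e.left_inv he]
    rfl

/-- Closed curves in balls of radius `ε` are null-homologous. -/
def SmallLoopsVanish (X : Type u) [MetricSpace X] (G : Type u) [AddCommGroup G] (ε : ℝ) : Prop :=
  ∀ (x : X) (p : C(ℝ, X)) (a b : ℝ), a ≤ b → p a = p b → (∀ t ∈ Icc a b, p t ∈ Metric.ball x ε) →
    segClass G p a b = 0

/-- `ε` is a Lebesgue number of the cover by the open sets in which loops contract. -/
theorem IsSurface.exists_smallLoopsVanish [CompactSpace X] (hX : IsSurface X) :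
    ∃ ε > 0, SmallLoopsVanish X G ε := by
  choose U hU hxU hnull using hX.exists_isOpen_homotopic
  obtain ⟨ε, hε, h⟩ := lebesgue_number_lemma_of_metric isCompact_univ hU
    (fun x _ => mem_iUnion.2 ⟨x, hxU x⟩)
  refine ⟨ε, hε, fun x p a b hab hp hball => ?_⟩
  obtain ⟨y, hy⟩ := h x (mem_univ x)
  rw [← Loop.segClass_ofArc G p a b hp]
  refine (Loop.segClass_eq_of_homotopic (hnull y _ ?_)).trans (segClass_const y 0 1)
  rw [← Loop.range_line]
  rintro _ ⟨t, rfl⟩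
  have hf : Int.fract t ∈ Icc (0 : ℝ) 1 := ⟨Int.fract_nonneg t, (Int.fract_lt_one t).le⟩
  have h1 := Loop.line_add_int (Loop.ofArc p a b hp) (Int.fract t) ⌊t⌋
  rw [Int.fract_add_floor] at h1
  rw [h1, Loop.line_ofArc _ _ _ _ hf]
  refine hy (hball _ ⟨?_, ?_⟩) <;> nlinarith [hf.1, hf.2]

variable {G}

/-- The curve `p` followed by the reverse of `q` is a closed curve in the ball. -/
theorem SmallLoopsVanish.segClass_eq {ε : ℝ} (hε : SmallLoopsVanish X G ε) {p q : C(ℝ, X)}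
    {a b c d : ℝ} (hab : a ≤ b) (hcd : c ≤ d) (h₀ : p a = q c) (h₁ : p b = q d) (x : X)
    (hp : ∀ t ∈ Icc a b, p t ∈ Metric.ball x ε) (hq : ∀ t ∈ Icc c d, q t ∈ Metric.ball x ε) :
    segClass G p a b = segClass G q c d := by
  have hj : p b = reverse q d 0 := by rw [reverse_apply, sub_zero, h₁]
  have hdc : (0 : ℝ) ≤ d - c := by linarith
  have h := segClass_concat (G := G) hj hab hdc
  rw [segClass_reverse, hε x, eq_comm, ← sub_eq_add_neg, sub_eq_zero] at h
  · exact h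
  · linarith
  · rw [concat_of_le hj hab, concat_of_ge hj (by linarith), reverse_apply, h₀]
    congr 1
    ring
  · intro t ht
    refine concat_mem hj hp (fun t ht => ?_) ht
    rw [reverse_apply]
    exact hq _ ⟨by linarith [ht.2], by linarith [ht.1]⟩

/-- Loops with a common Lipschitz constant which are close at sufficiently many points are
homologous. -/
theorem SmallLoopsVanish.homologyClass_eq {ε : ℝ} (hε : SmallLoopsVanish X G ε)
    (hX : IsGeodesicSpace X) {γ γ' : Loop X} {K : ℝ} {n : ℕ} (hn : 0 < n) (hK : K / n < ε / 4)
    (hγ : ∀ s t, dist (γ.line s) (γ.line t) ≤ K * |s - t|)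
    (hγ' : ∀ s t, dist (γ'.line s) (γ'.line t) ≤ K * |s - t|)
    (hd : ∀ i ≤ n, dist (γ.line (i / n)) (γ'.line (i / n)) < ε / 4) :
    γ.homologyClass G = γ'.homologyClass G := by
  have hn' : (0 : ℝ) < n := by exact_mod_cast hn
  choose g g0 g1 hg using hX.exists_curve
  have hgball : ∀ x y, ∀ t ∈ Icc 0 (dist x y), dist (g x y t) x ≤ dist x y := fun x y t ht => by
    have := hg x y t ht 0 (left_mem_Icc.2 dist_nonneg)
    rw [g0, sub_zero, abs_of_nonneg ht.1] at this
    exact this.trans_le ht.2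
  let x : ℕ → X := fun i => γ.line (i / n)
  let y : ℕ → X := fun i => γ'.line (i / n)
  -- The loops are the sides of a ladder with geodesic rungs from `x i` to `y i`. Each cell lies in
  -- the ball of radius `ε` around `x i`, every point being less than two steps of `ε / 4` away, so
  -- the rung can be moved across it.
  have key : ∀ i ≤ n, segClass G γ.line 0 (i / n) + segClass G (g (x i) (y i)) 0 (dist (x i) (y i)) =
      segClass G (g (x 0) (y 0)) 0 (dist (x 0) (y 0)) + segClass G γ'.line 0 (i / n) := by
    intro i
    induction i with
    | zero => intro _; simp
    | succ i ih =>
      intro hi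
      have ih := ih (by omega)
      have hle : (i / n : ℝ) ≤ ((i + 1 : ℕ) : ℝ) / n := by gcongr; simp
      have hstep : ((i + 1 : ℕ) : ℝ) / n - i / n = 1 / n := by push_cast; ring
      have hK0 : ∀ t ∈ Icc (i / n : ℝ) (((i + 1 : ℕ) : ℝ) / n), ∀ δ : Loop X,
          (∀ s t, dist (δ.line s) (δ.line t) ≤ K * |s - t|) →
          dist (δ.line t) (δ.line (i / n)) < ε / 4 := fun t ht δ hδ => by
        have h1 := hδ (i / n + 1) (i / n)
        rw [add_sub_cancel_left, abs_one, mul_one] at h1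
        have hKnn : 0 ≤ K := dist_nonneg.trans h1
        refine (hδ _ _).trans_lt (lt_of_le_of_lt ?_ hK)
        rw [abs_of_nonneg (by linarith [ht.1]), div_eq_mul_one_div K]
        exact mul_le_mul_of_nonneg_left (by linarith [ht.2]) hKnn
      have j₁ : γ.line (((i + 1 : ℕ) : ℝ) / n) = g (x (i + 1)) (y (i + 1)) 0 := (g0 _ _).symm
      have j₂ : g (x i) (y i) (dist (x i) (y i)) = γ'.line (i / n) := g1 _ _
      have di : dist (x i) (y i) < ε / 4 := hd i (by omega)
      have di' : dist (x (i + 1)) (y (i + 1)) < ε / 4 := hd (i + 1) hi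
      have hxx : dist (x (i + 1)) (x i) < ε / 4 := hK0 _ (right_mem_Icc.2 hle) γ hγ
      have hq := hε.segClass_eq (p := concat _ _ _ _ j₁) (q := concat _ _ _ _ j₂)
        (a := i / n) (b := dist (x (i + 1)) (y (i + 1)) - 0 + ((i + 1 : ℕ) : ℝ) / n)
        (c := 0) (d := ((i + 1 : ℕ) : ℝ) / n - i / n + dist (x i) (y i))
        (by linarith [dist_nonneg (x := x (i + 1)) (y := y (i + 1))])
        (by linarith [dist_nonneg (x := x i) (y := y i)])
        (by rw [concat_of_le j₁ hle, concat_of_le j₂ dist_nonneg, g0])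
        (by
          rw [concat_of_ge j₁ (by linarith [dist_nonneg (x := x (i + 1)) (y := y (i + 1))]),
            concat_of_ge j₂ (by linarith), sub_zero, add_sub_cancel_right, add_zero, g1,
            add_sub_cancel_right, sub_add_cancel]) (x i)
        (fun t ht => concat_mem j₁ (fun t ht => ?_) (fun t ht => ?_) ht)
        (fun t ht => concat_mem j₂ (fun t ht => ?_) (fun t ht => ?_) ht)
      · rw [segClass_concat j₁ hle dist_nonneg, segClass_concat j₂ dist_nonneg hle] at hq
        rw [← segClass_add _ (0 : ℝ) (i / n : ℝ), add_assoc, hq, ← add_assoc, ih, add_assoc,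
          segClass_add]
      · have := hK0 t ht γ hγ
        rw [Metric.mem_ball]
        change _ < _ at this
        linarith [dist_nonneg (x := x (i + 1)) (y := x i)]
      · have h1 := hgball _ _ t ht
        rw [Metric.mem_ball]
        linarith [dist_triangle (g (x (i + 1)) (y (i + 1)) t) (x (i + 1)) (x i),
          dist_nonneg (x := x (i + 1)) (y := x i)]
      · have h1 := hgball _ _ t ht
        rw [Metric.mem_ball]
        linarith [dist_nonneg (x := x (i + 1)) (y := x i)]
      · have h1 := hK0 t ht γ' hγ'
        rw [Metric.mem_ball]
        have h2 := dist_triangle (γ'.line t) (y i) (x i)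
        rw [dist_comm (y i)] at h2
        linarith [dist_nonneg (x := x (i + 1)) (y := x i)]
  have h := key n le_rfl
  have e1 : ((n : ℕ) : ℝ) / n = 1 := div_self hn'.ne'
  have ex : x n = x 0 := by
    have := γ.line_add_one 0
    simp only [x, e1]
    simpa using this
  have ey : y n = y 0 := by
    have := γ'.line_add_one 0
    simp only [y, e1]
    simpa using this
  -- After a full turn the last rung is the first one, and it cancels.
  rw [ex, ey, e1, add_comm] at h
  exact Loop.homologyClass_eq_of_segClass_eq (add_left_cancel h)

end Small

/-! ### Decomposing loops into geodesic circles -/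

section Decompose

variable {X : Type u} [MetricSpace X] {G : Type u} [AddCommGroup G]

/-- The hypotheses make `γ` isometric, up to the factor `K`, on half turns. Any two points of the
circle have representatives at most half a turn apart, found by rounding, and their quotient
distance is measured there. -/
theorem isGeodesicCircle_of_le_dist {γ : Loop X} {K : ℝ} (hK : 0 < K)
    (hγ : ∀ s t, dist (γ.line s) (γ.line t) ≤ K * |s - t|)
    (h : ∀ s t, s ≤ t → t ≤ s + 1 / 2 → K * (t - s) ≤ dist (γ.line s) (γ.line t)) :
    IsGeodesicCircle γ := by
  have hper : Function.Periodic (fun t => γ.line (K⁻¹ * t)) K := fun t => by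
    simp only [mul_add, inv_mul_cancel₀ hK.ne', Loop.line_add_one]
  have hd : ∀ s t, |s - t| ≤ 1 / 2 → dist (γ.line s) (γ.line t) = K * |s - t| := by
    intro s t hst
    refine le_antisymm (hγ s t) ?_
    rcases le_total s t with hle | hle
    · rw [abs_of_nonpos (by linarith)] at hst ⊢
      rw [neg_sub]
      exact h s t hle (by linarith)
    · rw [abs_of_nonneg (by linarith)] at hst ⊢
      rw [dist_comm]
      exact h t s hle (by linarith)
  refine ⟨K, hK, hper.lift, Isometry.of_dist_eq fun a b => ?_, fun t => ?_⟩
  · obtain ⟨x, rfl⟩ := QuotientAddGroup.mk_surjective a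
    obtain ⟨y, rfl⟩ := QuotientAddGroup.mk_surjective b
    change dist (γ.line (K⁻¹ * x)) (γ.line (K⁻¹ * y)) = dist (x : AddCircle K) (y : AddCircle K)
    rw [dist_eq_norm, ← AddCircle.coe_sub, AddCircle.norm_eq' K hK,
      ← γ.line_add_int (K⁻¹ * y) (round (K⁻¹ * (x - y)))]
    have e : K⁻¹ * x - (K⁻¹ * y + (round (K⁻¹ * (x - y)) : ℤ)) =
        K⁻¹ * (x - y) - (round (K⁻¹ * (x - y)) : ℤ) := by ring
    rw [hd, e]
    rw [e]
    exact abs_sub_round _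
  · refine Eq.trans ?_ (hper.lift_coe (K * t)).symm
    simp only [inv_mul_cancel_left₀ hK.ne']
    rfl

theorem length_le_of_lipschitz {γ : Loop X} {K : ℝ}
    (hγ : ∀ s t, dist (γ.line s) (γ.line t) ≤ K * |s - t|) : γ.length ≤ ENNReal.ofReal K := by
  have hK : 0 ≤ K := dist_nonneg.trans ((hγ 1 0).trans_eq (by simp))
  have := eVariationOn_le_of_lipschitz (p := γ.line) hK (a := 0) (b := 1) fun s _ t _ => hγ s t
  rwa [sub_zero, mul_one] at this

variable (G) in
/-- A loop parametrized proportionally to arc length is null-homologous, a geodesic circle, or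
homologous to the sum of two shorter loops. -/
theorem exists_shortcut (hX : IsGeodesicSpace X) {γ : Loop X} {K : ℝ}
    (hγ : ∀ s t, dist (γ.line s) (γ.line t) ≤ K * |s - t|) :
    γ.homologyClass G = 0 ∨ IsGeodesicCircle γ ∨ ∃ γ₁ γ₂ : Loop X,
      γ₁.length < ENNReal.ofReal K ∧ γ₂.length < ENNReal.ofReal K ∧
      γ.homologyClass G = γ₁.homologyClass G + γ₂.homologyClass G := by
  have hK : 0 ≤ K := dist_nonneg.trans ((hγ 1 0).trans_eq (by simp))
  rcases hK.eq_or_lt with rfl | hK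
  · left
    have : γ.line = .const ℝ (γ.line 0) := ContinuousMap.ext fun t => by
      have := hγ t 0
      rw [zero_mul] at this
      exact dist_le_zero.1 this
    exact Loop.homologyClass_eq_zero (by rw [this]; exact segClass_const _ _ _)
  right
  by_cases h : ∀ s t, s ≤ t → t ≤ s + 1 / 2 → K * (t - s) ≤ dist (γ.line s) (γ.line t)
  · exact Or.inl (isGeodesicCircle_of_le_dist hK hγ h)
  right
  push Not at h
  -- The chord has length `d < K * (t - s) ≤ K / 2`. The loop over `[s, t]` closed by the chord is
  -- thus shorter than `K`, and so is the rest of `γ` with the chord in place of that arc. The chord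
  -- occurs in opposite directions and drops out of the sum.
  obtain ⟨s, t, hst, hts, hd⟩ := h
  obtain ⟨p, p0, p1, hp⟩ := hX.exists_curve (γ.line s) (γ.line t)
  set d := dist (γ.line s) (γ.line t)
  have hd0 : 0 ≤ d := dist_nonneg
  have hlenp : eVariationOn p (Icc 0 d) ≤ ENNReal.ofReal d := by
    simpa using eVariationOn_le_of_lipschitz (p := p) zero_le_one (a := 0) (b := d)
      fun s hs t ht => by rw [hp s hs t ht, one_mul]
  have hlenr : eVariationOn (reverse p d) (Icc 0 (d - 0)) ≤ ENNReal.ofReal d := by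
    have := eVariationOn_le_of_lipschitz (p := reverse p d) zero_le_one (a := 0) (b := d)
      fun x hx y hy => by
        rw [reverse_apply, reverse_apply, hp _ ⟨by linarith [hx.2], by linarith [hx.1]⟩ _
          ⟨by linarith [hy.2], by linarith [hy.1]⟩, one_mul, abs_sub_comm, sub_sub_sub_cancel_left]
    simpa using this
  have hlen : ∀ a b, eVariationOn γ.line (Icc a b) ≤ ENNReal.ofReal (K * (b - a)) := fun a b =>
    eVariationOn_le_of_lipschitz hK.le fun x _ y _ => hγ x y
  have j₁ : γ.line t = reverse p d 0 := by rw [reverse_apply, sub_zero, p1]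
  have j₂ : p d = γ.line t := p1
  have hKt : K * t ≤ K * (s + 1 / 2) := mul_le_mul_of_nonneg_left hts hK.le
  have hdr : (0 : ℝ) ≤ d - 0 := by linarith
  have c₁ : concat γ.line (reverse p d) t 0 j₁ s =
      concat γ.line (reverse p d) t 0 j₁ (d - 0 - 0 + t) := by
    rw [concat_of_le _ hst, concat_of_ge _ (by linarith), reverse_apply, ← p0]
    congr 1
    ring
  have c₂ : concat p γ.line d t j₂ 0 = concat p γ.line d t j₂ (s + 1 - t + d) := by
    rw [concat_of_le _ hd0, concat_of_ge _ (by linarith), p0, ← γ.line_add_one]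
    congr 1
    ring
  refine ⟨Loop.ofArc _ _ _ c₁, Loop.ofArc _ _ _ c₂, ?_, ?_, ?_⟩
  · rw [Loop.length_ofArc _ _ (by linarith), eVariationOn_concat j₁ hst hdr]
    refine (add_le_add (hlen s t) hlenr).trans_lt ?_
    rw [← ENNReal.ofReal_add (mul_nonneg hK.le (by linarith)) hd0]
    exact ENNReal.ofReal_lt_ofReal_iff_of_nonneg (by nlinarith) |>.2 (by linarith)
  · rw [Loop.length_ofArc _ _ (by linarith), eVariationOn_concat j₂ hd0 (by linarith)]
    refine (add_le_add hlenp (hlen t (s + 1))).trans_lt ?_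
    rw [← ENNReal.ofReal_add hd0 (mul_nonneg hK.le (by linarith))]
    exact ENNReal.ofReal_lt_ofReal_iff_of_nonneg
      (add_nonneg hd0 (mul_nonneg hK.le (by linarith))) |>.2 (by linarith)
  · apply Loop.homologyClass_eq_add
    have h1 : segClass G γ.line 0 s = segClass G γ.line 1 (s + 1) := by
      refine pathClass_congr fun x => ?_
      rw [segPath_apply, segPath_apply, ← Loop.line_add_one]
      congr 1
      simp only [smul_eq_mul]
      ring
    have h2 := segClass_add (G := G) γ.line 0 1 (s + 1)
    have h3 := segClass_add (G := G) γ.line 0 s (s + 1)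
    have h4 := segClass_add (G := G) γ.line s t (s + 1)
    have h5 := segClass_reverse (G := G) p 0 d
    rw [Loop.segClass_ofArc, Loop.segClass_ofArc, segClass_concat j₁ hst hdr,
      segClass_concat j₂ hd0 (by linarith), h5, add_assoc, neg_add_cancel_left, h4]
    rw [← h3, h1, add_comm] at h2
    exact add_left_cancel h2

/-- In a compact geodesic surface, the loops shorter than `M` are homologous to combinations of
geodesic circles shorter than `M`. -/
theorem homologyClass_mem_of_length_lt [CompactSpace X] (hX : IsGeodesicSurface X)
    (S : AddSubgroup (H₁ X G)) {M : ENNReal}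
    (hS : ∀ γ : Loop X, IsGeodesicCircle γ → γ.length < M → ∀ a, γ.homologyClass G a ∈ S)
    {β : Loop X} (hβ : β.length < M) (a : G) : β.homologyClass G a ∈ S := by
  by_contra hbad
  obtain ⟨ε, hε, hsmall⟩ := hX.surface.exists_smallLoopsVanish G
  set K₀ := β.length.toReal with hK₀
  have hβfin : β.length ≠ ⊤ := hβ.ne_top
  -- the loops which are not combinations of short geodesic circles
  let Z : Set (ℝ × (UnitAddCircle → X)) := {z | z.1 ∈ Icc 0 K₀ ∧
    (∀ s t : ℝ, dist (z.2 s) (z.2 t) ≤ z.1 * |s - t|) ∧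
    ∃ γ : Loop X, ⇑γ = z.2 ∧ ∃ a, γ.homologyClass G a ∉ S}
  -- The functions carry the topology of pointwise convergence, so compactness comes from Tychonoff.
  -- For closedness, a point of `Z` near a limit point is close to it at `n + 1` parameters; with
  -- the common Lipschitz constant `K₀` the two loops are homologous.
  have hZcl : IsClosed Z := by
    refine isClosed_of_closure_subset fun z hz => ?_
    have hz₁ : z.1 ∈ Icc 0 K₀ := closure_minimal (t := Prod.fst ⁻¹' Icc 0 K₀)
      (fun z hz => hz.1) (isClosed_Icc.preimage continuous_fst) hz
    have hz₂ : ∀ s t : ℝ, dist (z.2 s) (z.2 t) ≤ z.1 * |s - t| := fun s t =>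
      closure_minimal (t := {z : ℝ × (UnitAddCircle → X) | dist (z.2 s) (z.2 t) ≤ z.1 * |s - t|})
        (fun z hz => hz.2.1 s t) (isClosed_le (by fun_prop) (by fun_prop)) hz
    have hlip : LipschitzWith z.1.toNNReal fun t : ℝ => z.2 t := LipschitzWith.of_dist_le_mul
      fun s t => by rw [Real.coe_toNNReal _ hz₁.1]; exact hz₂ s t
    let γ : Loop X := ⟨z.2, (QuotientAddGroup.isQuotientMap_mk
      (N := AddSubgroup.zmultiples (1 : ℝ))).continuous_iff.2 hlip.continuous⟩
    refine ⟨hz₁, hz₂, γ, rfl, ?_⟩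
    obtain ⟨n, hn⟩ := exists_nat_gt (K₀ / (ε / 4))
    have hn0 : 0 < n := by
      have : (0 : ℝ) < n := lt_of_le_of_lt (div_nonneg ENNReal.toReal_nonneg (by linarith)) hn
      exact_mod_cast this
    have hKn : K₀ / n < ε / 4 := by
      rw [div_lt_iff₀ (by linarith)] at hn
      rw [div_lt_iff₀ (by exact_mod_cast hn0)]
      linarith
    have hopen : {w : ℝ × (UnitAddCircle → X) | ∀ i ∈ Finset.range (n + 1),
        dist (z.2 ((i / n : ℝ) : UnitAddCircle)) (w.2 ((i / n : ℝ) : UnitAddCircle)) < ε / 4} ∈ 𝓝 z := by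
      refine (Filter.eventually_all_finset (Finset.range (n + 1))).2 fun i _ => ?_
      refine ContinuousAt.eventually_lt (by fun_prop) continuousAt_const ?_
      rw [dist_self]
      linarith
    obtain ⟨w, hwn, hw₁, hw₂, γ', hγ', b, hb⟩ := mem_closure_iff_nhds.1 hz _ hopen
    refine ⟨b, ?_⟩
    have := hsmall.homologyClass_eq hX.geodesic (γ := γ) (γ' := γ') hn0 hKn
      (fun s t => (hz₂ s t).trans (mul_le_mul_of_nonneg_right hz₁.2 (abs_nonneg _)))
      (fun s t => by
        rw [Loop.line_apply, Loop.line_apply, hγ']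
        exact (hw₂ s t).trans (mul_le_mul_of_nonneg_right hw₁.2 (abs_nonneg _)))
      (fun i hi => by
        rw [Loop.line_apply, Loop.line_apply, hγ']
        exact hwn i (Finset.mem_range.2 (by omega)))
    rwa [this]
  have hZc : IsCompact Z := (isCompact_Icc.prod isCompact_univ).of_isClosed_subset hZcl
    fun z hz => ⟨hz.1, trivial⟩
  have hmem : ∀ δ : Loop X, δ.length ≤ ENNReal.ofReal K₀ → ∀ b, δ.homologyClass G b ∉ S →
      ∃ z ∈ Z, z.1 = δ.length.toReal := by
    intro δ hδ b hb
    have hδfin : δ.length ≠ ⊤ := ne_top_of_le_ne_top ENNReal.ofReal_ne_top hδ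
    obtain ⟨δ', -, hδc, hδl⟩ := Loop.exists_lipschitz G δ hδfin
    exact ⟨(δ.length.toReal, δ'), ⟨⟨ENNReal.toReal_nonneg,
      ENNReal.toReal_le_of_le_ofReal ENNReal.toReal_nonneg hδ⟩, hδl, δ', rfl, b, by rwa [hδc]⟩, rfl⟩
  obtain ⟨z₀, hz₀, -⟩ := hmem β (by rw [hK₀, ENNReal.ofReal_toReal hβfin]) a hbad
  -- A bad loop with least Lipschitz constant `K`. Every loop shorter than `K` is then good, since
  -- its arc length parametrization would otherwise give a smaller constant.
  obtain ⟨⟨K, f⟩, ⟨hK, hf, γ, rfl, b, hb⟩, hmin⟩ :=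
    hZc.exists_isMinOn ⟨z₀, hz₀⟩ continuous_fst.continuousOn
  dsimp only at hK hf
  have hgood : ∀ δ : Loop X, δ.length < ENNReal.ofReal K → ∀ b, δ.homologyClass G b ∈ S := by
    intro δ hδ b
    by_contra hb
    obtain ⟨z, hz, hzδ⟩ := hmem δ (hδ.le.trans (ENNReal.ofReal_le_ofReal hK.2)) b hb
    have h1 : K ≤ z.1 := hmin hz
    rw [hzδ] at h1
    exact absurd (ENNReal.ofReal_le_of_le_toReal h1) hδ.not_ge
  rcases exists_shortcut G hX.geodesic (γ := γ) hf with h | h | ⟨γ₁, γ₂, h₁, h₂, h⟩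
  · rw [h] at hb
    exact hb S.zero_mem
  · refine hb (hS γ h (lt_of_le_of_lt (length_le_of_lipschitz hf) ?_) b)
    refine lt_of_le_of_lt (ENNReal.ofReal_le_ofReal hK.2) ?_
    rwa [hK₀, ENNReal.ofReal_toReal hβfin]
  · rw [h] at hb
    exact hb (S.add_mem (hgood γ₁ h₁ b) (hgood γ₂ h₂ b))

/-- This turns membership in a subgroup back into an explicit sum; signs are absorbed into the
coefficients. -/
theorem exists_sum_of_mem_closure (p : Loop X → Prop) {x : H₁ X G}
    (hx : x ∈ AddSubgroup.closure {x | ∃ γ b, p γ ∧ x = Loop.homologyClass γ G b}) :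
    ∃ (m : ℕ) (b : Fin m → G) (γ : Fin m → Loop X), (∀ j, p (γ j)) ∧
      x = ∑ j, (γ j).homologyClass G (b j) := by
  induction hx using AddSubgroup.closure_induction with
  | mem x hx =>
    obtain ⟨γ, b, hp, rfl⟩ := hx
    exact ⟨1, fun _ => b, fun _ => γ, fun _ => hp, by simp⟩
  | zero => exact ⟨0, Fin.elim0, Fin.elim0, fun j => j.elim0, by simp⟩
  | add x y _ _ hx hy =>
    obtain ⟨m, b, γ, h, rfl⟩ := hx
    obtain ⟨m', b', γ', h', rfl⟩ := hy
    refine ⟨m + m', Fin.append b b', Fin.append γ γ', fun j => ?_, ?_⟩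
    · refine Fin.addCases (fun i => ?_) (fun i => ?_) j
      · rw [Fin.append_left]; exact h i
      · rw [Fin.append_right]; exact h' i
    · rw [Fin.sum_univ_add]
      simp only [Fin.append_left, Fin.append_right]
  | neg x _ hx =>
    obtain ⟨m, b, γ, h, rfl⟩ := hx
    exact ⟨m, fun j => -b j, γ, h, by simp [map_neg]⟩

end Decompose

end GeodesicSurface

/-! ### The proposition -/

open GeodesicSurface
theorem proposition7p2 {X : Type u} [MetricSpace X]
    (hX : IsGeodesicSurface X)
    (α : Loop X) (hα : Function.Injective α)
    {D₁ D₂ : ℝ} (hD₁ : 0 < D₁) (hD : D₁ ≤ D₂)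
    (hD₂ : α.length / 2 ≤ ENNReal.ofReal D₂)
    (P : IsolatingPair α D₁ D₂)
    {G : Type u} [AddCommGroup G] (g : G)
    {k : ℕ} (c : Fin k → G) (β : Fin k → Loop X)
    (hβ_length : ∀ i, (β i).length ≤ α.length)
    (hβ_ne : ∀ i, range (β i) ≠ range α)
    (hαβ : α.homologyClass G g = ∑ i, (β i).homologyClass G (c i)) :
    -- if `X` is compact, the loops can be chosen to be geodesic circles
    (CompactSpace X →
      ∃ (m : ℕ) (b : Fin m → G) (γ : Fin m → Loop X),
        (∀ j, IsGeodesicCircle (γ j)) ∧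
        (∀ j, (γ j).length ≤ α.length) ∧
        (∀ j, range (γ j) ≠ range α) ∧
        α.homologyClass G g = ∑ j, (γ j).homologyClass G (b j) ∧
        ((∀ i, (β i).length < α.length) ∨ P.IsStrict → ∀ j, Disjoint (range (γ j)) P.N₁)) ∧
    -- the given loops which meet `N₁` are superfluous
    ((∀ i, (β i).length < α.length) ∨ P.IsStrict →
      ∀ i, ¬ Disjoint (range (β i)) P.N₁ → ∀ a : G, (β i).homologyClass G a = 0) := by
  have hfin : α.length ≠ ⊤ := fun h => by
    rw [h, ENNReal.top_div_of_ne_top (by simp), top_le_iff] at hD₂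
    exact ENNReal.ofReal_ne_top hD₂
  have hD₂' : α.length.toReal / 2 ≤ D₂ := by
    have := ENNReal.toReal_le_of_le_ofReal (hD₁.le.trans hD) hD₂
    rwa [ENNReal.toReal_div, ENNReal.toReal_ofNat] at this
  have short : ∀ γ : Loop X, γ.length < α.length → ¬ Disjoint (range γ) P.N₁ →
      γ.homologyClass G = 0 := fun γ hγ hN =>
    P.homologyClass_eq_zero_of_length_lt hX hα hfin hD₂' hγ hN G
  refine ⟨fun hcpt => ?_, ?_⟩
  -- Disjointness from `N₁` enters `p` as a conditional clause, so a single subgroup `S` serves both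
  -- assertions about the circles.
  · let p : Loop X → Prop := fun γ => IsGeodesicCircle γ ∧ γ.length ≤ α.length ∧
      range γ ≠ range α ∧ ((∀ i, (β i).length < α.length) ∨ P.IsStrict → Disjoint (range γ) P.N₁)
    let S : AddSubgroup (H₁ X G) :=
      AddSubgroup.closure {x | ∃ γ b, p γ ∧ x = Loop.homologyClass γ G b}
    have hpS : ∀ γ, p γ → ∀ b, γ.homologyClass G b ∈ S := fun γ hγ b =>
      AddSubgroup.subset_closure ⟨γ, b, hγ, rfl⟩
    have hdisj : ∀ γ : Loop X, Disjoint (range γ) P.N₁ → range γ ≠ range α := fun γ h he => by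
      rw [he] at h
      exact (range_nonempty α).ne_empty (disjoint_self.1 (h.mono_right P.range_subset))
    have hcirc : ∀ γ : Loop X, IsGeodesicCircle γ → γ.length < α.length →
        ∀ b, γ.homologyClass G b ∈ S := by
      intro γ hγ hlt b
      by_cases hN : Disjoint (range γ) P.N₁
      · exact hpS γ ⟨hγ, hlt.le, hdisj γ hN, fun _ => hN⟩ b
      · rw [short γ hlt hN]
        exact S.zero_mem
    have hlt : ∀ γ : Loop X, γ.length < α.length → ∀ b, γ.homologyClass G b ∈ S :=
      fun γ hγ b => homologyClass_mem_of_length_lt hX S hcirc hγ b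
    have hβS : ∀ i b, (β i).homologyClass G b ∈ S := by
      intro i b
      -- A loop shorter than `α` is handled by compactness. One of the same length is cut once: its
      -- pieces are shorter, and if it is itself a geodesic circle, its image still differs from
      -- that of `α`.
      rcases (hβ_length i).lt_or_eq with hi | hi
      · exact hlt _ hi b
      have hβfin : (β i).length ≠ ⊤ := hi ▸ hfin
      obtain ⟨γ, hγr, hγc, hγl⟩ := Loop.exists_lipschitz G (β i) hβfin
      have hof : ENNReal.ofReal (β i).length.toReal = α.length := by
        rw [ENNReal.ofReal_toReal hβfin, hi]
      have hγα : γ.length ≤ α.length := hof ▸ length_le_of_lipschitz hγl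
      have hγne : range γ ≠ range α := hγr ▸ hβ_ne i
      rw [← hγc]
      rcases exists_shortcut G hX.geodesic hγl with h | h | ⟨γ₁, γ₂, h₁, h₂, h⟩
      · rw [h]
        exact S.zero_mem
      -- If the conditional clause fails, not all `β i` can be shorter, as this one has length
      -- `|α|`. So the isolation is strict, and the class vanishes.
      · by_cases hN : ((∀ i, (β i).length < α.length) ∨ P.IsStrict → Disjoint (range γ) P.N₁)
        · exact hpS γ ⟨h, hγα, hγne, hN⟩ b
        · push Not at hN
          obtain ⟨hs | hs, hN⟩ := hN
          · exact absurd hi (hs i).ne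
          · rw [hs.homologyClass_eq_zero hX hα hfin hD₂' hγα hγne hN G]
            exact S.zero_mem
      · rw [hof] at h₁ h₂
        rw [h]
        exact S.add_mem (hlt γ₁ h₁ b) (hlt γ₂ h₂ b)
    obtain ⟨m, b, γ, hp, hsum⟩ := exists_sum_of_mem_closure p
      (x := α.homologyClass G g) (by rw [hαβ]; exact S.sum_mem fun i _ => hβS i _)
    exact ⟨m, b, γ, fun j => (hp j).1, fun j => (hp j).2.1, fun j => (hp j).2.2.1, hsum,
      fun h j => (hp j).2.2.2 h⟩
  · rintro (h | h) i hN a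
    · rw [short _ (h i) hN]
      rfl
    · rw [h.homologyClass_eq_zero hX hα hfin hD₂' (hβ_length i) (hβ_ne i) hN G]
      rfl
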